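/- Let $d\ge 1$ be a squarefree integer, $F=\mathbb{Q}(\sqrt{-d})\subset\mathbb{C}$ (with $\sqrt{-d}=i\sqrt d$), and let $p$ be a prime number that splits completely in $F/\mathbb{Q}$. Fix a field isomorphism $\mathbb{C}\simeq\overline{\mathbb{Q}}_p$, and let $\mathfrak{p}$ be the prime ideal of $\mathcal{O}_F$ above $p$ corresponding to the embedding $F\subset\mathbb{C}\simeq\overline{\mathbb{Q}}_p$, that is, $\mathfrak p=\{x\in\mathcal{O}_F : |x|_p<1\}$. Let $\theta=\frac{-1+\sqrt{-d}}{2}$ if $-d\equiv 1 \bmod 4$, and $\theta=\sqrt{-d}$ otherwise, so that $\mathcal{O}_F=\mathbb{Z}[\theta]$. Let $\mathcal{D}=\{z\in\mathbb{C} : \operatorname{Im} z>0,\ |z|>1,\ -\tfrac12\le\operatorname{Re} z<\tfrac12\}\cup\{e^{i\varphi} : \tfrac{\pi}{2}\le\varphi\le\tfrac{2\pi}{3}\}$. The $\{\infty,p\}$-continued fraction expansion of $\theta$ is defined as follows. Put $x_1=\theta$. For $k\ge1$: * (initialization) if $x_k\in\mathbb{Z}_p$, put $\delta_k=1$, $z_k=x_k$,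 $D_k=\begin{pmatrix}1&0\\0&1\end{pmatrix}$; otherwise put $\delta_k=-1$, $z_k=-1/x_k$, $D_k=\begin{pmatrix}0&-1\\1&0\end{pmatrix}$; * ($p$-adic reduction) let $a_k\in\{0,\dots,p^2-1\}$ be such that $z_k-a_k\in p^2\mathbb{Z}_p$, and put $z_{k0}=(z_k-a_k)/p^2$, $P_k=\begin{pmatrix}1/p&0\\0&p\end{pmatrix}\begin{pmatrix}1&-a_k\\0&1\end{pmatrix}$; * ($\infty$-adic reduction) for $j=0,1,2,\dots$: if $z_{kj}\in\mathcal{D}$, put $x_{k+1}=z_{kj}$ and stop; otherwise let $b_{kj}$ be the integer with $-\frac12\le\operatorname{Re}(z_{kj}-b_{kj})<\frac12$, except that $b_{kj}=0$ if $z_{kj}=e^{i\pi/3}$, and put $z_{k,j+1}=-1/(z_{kj}-b_{kj})$. If $b_{k0},\dots,b_{kl_k}$ are the integers obtained, put $Q_k=\begin{pmatrix}0&-1\\1&-b_{kl_k}\end{pmatrix}\cdots\begin{pmatrix}0&-1\\1&-b_{k0}\end{pmatrix}$ (the identity if there are none). Put $A_k=(Q_kP_kD_k)^{-1}$ and $B_k=A_1\cdots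 A_k$. (The exception at $e^{i\pi/3}$ can occur only for $d=3$.) Then the algorithm is well defined: every $x_k$ and all digits exist and are uniquely determined. Moreover: (i) The expansion is purely periodic: there is $N\geq 1$ with $x_{N+1}=x_1=\theta$ and $x_{k+N}=x_k$, $\delta_{k+N}=\delta_k$, $a_{k+N}=a_k$, $(b_{k+N,j})_j=(b_{kj})_j$ for all $k\ge1$. Now let $N$ be the smallest positive integer with $x_{N+1}=\theta$, and write $B_N^{-1}=\begin{pmatrix}q_N&r_N\\s_N&t_N\end{pmatrix}$, which lies in $SL_2(\mathbb{Z}[1/p])$. (ii) $\epsilon=s_N\theta+t_N$ is a fundamental norm one $p$-unit of $F$: it belongs to $\mathcal{O}_F[1/p]^1=\{x\in\mathcal{O}_F[1/p]^\times : N_{F/\mathbb{Q}}(x)=1\}$, and its class generates $\mathcal{O}_F[1/p]^1/(\mathrm{tor})$, which is infinite cyclic. (iii) $s=p^Ns_N$ and $t=p^Nt_N$ are relatively prime integers, and $u=p^N\epsilon=s\theta+t\in\mathcal{O}_F$ satisfies $u\mathcal{O}_F=\mathfrak{p}^{2N}$. If there is $x\in\mathcal{O}_F$ such that $u/x^2$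 is a root of unity, then the class of $\mathfrak{p}$ in the ideal class group of $\mathcal{O}_F$ has order $N$; otherwise it has order $2N$. -/

import Mathlib

open scoped NumberField nonZeroDivisors

noncomputable section

namespace PCF

/-! ### The field, the number `θ`, and the prime above `p` -/

/-- The complex number `√-d = i√d`. -/
def sqrtNeg (d : ℕ) : ℂ := Complex.I * (Real.sqrt d : ℂ)

/-- The imaginary quadratic field `F = ℚ(√-d)`, as a subfield of `ℂ`. -/
abbrev F (d : ℕ) : IntermediateField ℚ ℂ := IntermediateField.adjoin ℚ {sqrtNeg d}

theorem sqrtNeg_sq (d : ℕ) : sqrtNeg d ^ 2 = -(d : ℂ) := by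
  have h : ((Real.sqrt d : ℝ) : ℂ) ^ 2 = (d : ℂ) := by
    rw [← Complex.ofReal_pow, Real.sq_sqrt (Nat.cast_nonneg d)]
    simp
  rw [sqrtNeg, mul_pow, Complex.I_sq, h]
  ring

instance numberField_F (d : ℕ) : NumberField (F d) where
  to_charZero := inferInstance
  to_finiteDimensional := by
    apply IntermediateField.adjoin.finiteDimensional
    refine ⟨Polynomial.X ^ 2 + Polynomial.C (d : ℚ),
      Polynomial.monic_X_pow_add_C _ two_ne_zero, ?_⟩
    simp [sqrtNeg_sq]

/-- The standard generator of the ring of integers of `ℚ(√-d)`: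
`(-1 + √-d)/2` if `-d ≡ 1 mod 4`, and `√-d` otherwise. -/
def theta (d : ℕ) : ℂ :=
  if -(d : ℤ) ≡ 1 [ZMOD 4] then (-1 + sqrtNeg d) / 2 else sqrtNeg d

/-- `p` splits completely in the number field `K`: the number of primes above `p` is `[K : ℚ]`. -/
def SplitsCompletely (p : ℕ) (K : Type*) [Field K] [NumberField K] : Prop :=
  ((Ideal.span {(p : ℤ)}).primesOver (𝓞 K)).ncard = Module.finrank ℚ K

variable {p : ℕ} [Fact p.Prime]

theorem norm_le_one (ι : ℂ ≃+* PadicAlgCl p) {d : ℕ} (x : 𝓞 (F d)) :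
    ‖ι ((x : F d) : ℂ)‖ ≤ 1 := by
  have h : IsIntegral ℤ (ι ((x : F d) : ℂ)) := by
    have h1 : IsIntegral ℤ (x : F d) := x.isIntegral_coe
    exact h1.map ((ι : ℂ →+* PadicAlgCl p).comp (algebraMap (F d) ℂ)).toIntAlgHom
  have h2 : IsIntegral (Valued.v (R := PadicAlgCl p)).integer (ι ((x : F d) : ℂ)) :=
    h.tower_top
  have h3 := Valuation.Integers.mem_of_integral
    (Valuation.integer.integers (Valued.v (R := PadicAlgCl p))) h2
  rw [Valuation.mem_integer_iff, PadicAlgCl.valuation_def] at h3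
  exact_mod_cast h3

/-- The prime ideal `𝔭` of `𝓞 F` above `p` that corresponds to the embedding
`F ⊂ ℂ ≃ ℚ̄_p`: the integers of `F` whose image in `ℚ̄_p` has absolute value `< 1`. -/
def primeAbove (ι : ℂ ≃+* PadicAlgCl p) (d : ℕ) : Ideal (𝓞 (F d)) where
  carrier := {x | ‖ι ((x : F d) : ℂ)‖ < 1}
  zero_mem' := by simp
  add_mem' := by
    intro x y hx hy
    simp only [Set.mem_ofPred_eq, map_add, IntermediateField.coe_add] at hx hy ⊢
    exact lt_of_le_of_lt (IsUltrametricDist.norm_add_le_max _ _) (max_lt hx hy)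
  smul_mem' := by
    intro c x hx
    simp only [Set.mem_ofPred_eq, smul_eq_mul, map_mul, IntermediateField.coe_mul,
      norm_mul] at hx ⊢
    exact lt_of_le_of_lt (mul_le_of_le_one_left (norm_nonneg _) (norm_le_one ι c)) hx

theorem primeAbove_ne_bot (ι : ℂ ≃+* PadicAlgCl p) (d : ℕ) : primeAbove ι d ≠ ⊥ := by
  intro h
  have hp : ((p : ℕ) : 𝓞 (F d)) ∈ primeAbove ι d := by
    change ‖ι (((p : 𝓞 (F d)) : F d) : ℂ)‖ < 1
    have h1 : ι (((p : 𝓞 (F d)) : F d) : ℂ) = algebraMap ℚ_[p] (PadicAlgCl p) (p : ℚ_[p]) := by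
      simp
    rw [h1, PadicAlgCl.norm_extends]
    exact Padic.norm_p_lt_one
  rw [h, Ideal.mem_bot] at hp
  exact (Fact.out : p.Prime).ne_zero (by exact_mod_cast hp)

/-- The ideal class `[𝔭]`. -/
def primeClass (ι : ℂ ≃+* PadicAlgCl p) (d : ℕ) : ClassGroup (𝓞 (F d)) :=
  ClassGroup.mk0 ⟨primeAbove ι d, mem_nonZeroDivisors_of_ne_zero (primeAbove_ne_bot ι d)⟩

/-! ### Norm one `p`-units -/

/-- The ring `𝓞 F[1/p]`, inside `F`. -/
abbrev pIntegers (p d : ℕ) : Subalgebra (𝓞 (F d)) (F d) :=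
  Algebra.adjoin (𝓞 (F d)) {((p : F d))⁻¹}

/-- The group `𝓞 F[1/p]¹` of units of `𝓞 F[1/p]` of norm `1` over `ℚ`. -/
abbrev normOneUnits (p d : ℕ) : Subgroup (pIntegers p d)ˣ :=
  ((Algebra.norm ℚ (S := F d)).comp
    (((pIntegers p d).val : pIntegers p d →* F d).comp (Units.coeHom (pIntegers p d)))).ker

/-- `ε` is a fundamental norm one `p`-unit of `F = ℚ(√-d)`: it lies in `𝓞 F[1/p]¹`, and its class
generates the quotient of this group by its torsion subgroup, which is infinite cyclic. -/
def IsFundamentalNormOneUnit (p d : ℕ) (ε : ℂ) : Prop :=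
  ∃ η : normOneUnits p d,
    ((((η : (pIntegers p d)ˣ) : pIntegers p d) : F d) : ℂ) = ε ∧
    Subgroup.zpowers (η : normOneUnits p d ⧸ CommGroup.torsion (normOneUnits p d)) = ⊤ ∧
    ¬ IsOfFinOrder (η : normOneUnits p d ⧸ CommGroup.torsion (normOneUnits p d))

/-! ### The `{∞, p}`-continued fraction algorithm -/

/-- The fundamental domain
`𝒟 = {|z| > 1, -1/2 ≤ Re z < 1/2} ∪ {e^{iφ} | π/2 ≤ φ ≤ 2π/3}` of `SL₂(ℤ)` on the upper
half plane. -/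
def fundDomain : Set ℂ :=
  {z | 0 < z.im ∧ 1 < ‖z‖ ∧ -1 / 2 ≤ z.re ∧ z.re < 1 / 2} ∪
  {z | ∃ φ : ℝ, Real.pi / 2 ≤ φ ∧ φ ≤ 2 * Real.pi / 3 ∧ z = Complex.exp (φ * Complex.I)}

/-- `z ∈ ℂ` lies in `ℤ_p` under the identification `ι : ℂ ≃ ℚ̄_p`. -/
def InZp (ι : ℂ ≃+* PadicAlgCl p) (z : ℂ) : Prop :=
  ∃ c : ℤ_[p], ι z = algebraMap ℚ_[p] (PadicAlgCl p) (c : ℚ_[p])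

/-- `b` is the integer subtracted from `z` in the `∞`-adic reduction: the one with
`-1/2 ≤ Re (z - b) < 1/2`.

There is one exception, at the point `e^{iπ/3}`, where `b = 0` is taken, so that the next point
is `-1/e^{iπ/3} = e^{2iπ/3} ∈ 𝒟`. The general rule would give `b = 1` and lead back to `e^{iπ/3}`
itself, so that the loop would never end. The exception concerns only points in the `SL₂(ℤ)`-orbit
of `e^{iπ/3}`; no other expansion is affected. -/
def IsDigit (z : ℂ) (b : ℤ) : Prop :=
  (z ≠ Complex.exp (Real.pi / 3 * Complex.I) ∧ -1 / 2 ≤ (z - b).re ∧ (z - b).re < 1 / 2) ∨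
  (z = Complex.exp (Real.pi / 3 * Complex.I) ∧ b = 0)

/-- `IsInftyReduction z [b₀, …, b_l] w`: the `∞`-adic reduction, started at `z`, stops after
finitely many steps at `w ∈ 𝒟`, having subtracted `b₀, …, b_l` in this order (the list is empty if
`z ∈ 𝒟` at the start). -/
def IsInftyReduction : ℂ → List ℤ → ℂ → Prop
  | z, [], w => z ∈ fundDomain ∧ w = z
  | z, b :: bs, w => z ∉ fundDomain ∧ IsDigit z b ∧ IsInftyReduction (-1 / (z - b)) bs w

/-- The data of an expansion. The loops are numbered from `0`: `x k`, `δ k`, `a k`, `b k` are the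
complete quotient, the sign, the `p`-adic digit and the list of `∞`-adic digits of the loop number
`k + 1` of the algorithm. -/
structure Expansion where
  x : ℕ → ℂ
  δ : ℕ → ℤ
  a : ℕ → ℕ
  b : ℕ → List ℤ

namespace Expansion

/-- `x k` if `δ k = 1`, and `-1 / x k` otherwise. -/
def z (E : Expansion) (k : ℕ) : ℂ := if E.δ k = 1 then E.x k else -1 / E.x k

/-- `E` is the `{∞, p}`-continued fraction expansion of `z₀`, that is, a run of the algorithm
started at `z₀`. -/
structure IsExpansionOf (E : Expansion) (ι : ℂ ≃+* PadicAlgCl p) (z₀ : ℂ) : Prop where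
  start : E.x 0 = z₀
  sign : ∀ k, (InZp ι (E.x k) ∧ E.δ k = 1) ∨ (¬ InZp ι (E.x k) ∧ E.δ k = -1)
  digit_lt : ∀ k, E.a k < p ^ 2
  digit_congr : ∀ k, InZp ι ((E.z k - E.a k) / (p : ℂ) ^ 2)
  reduction : ∀ k, IsInftyReduction ((E.z k - E.a k) / (p : ℂ) ^ 2) (E.b k) (E.x (k + 1))

end Expansion

/-! ### The matrices of the algorithm -/

/-- The matrix of the initialization step. -/
def matD (δ : ℤ) : Matrix.SpecialLinearGroup (Fin 2) ℚ :=
  if δ = 1 then 1 else ⟨!![0, -1; 1, 0], by simp⟩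

/-- The matrix `diag(1/p, p) * (1, -a; 0, 1)` of the `p`-adic reduction. -/
def matP (p : ℕ) [Fact p.Prime] (a : ℕ) : Matrix.SpecialLinearGroup (Fin 2) ℚ :=
  ⟨!![1 / (p : ℚ), 0; 0, (p : ℚ)] * !![1, -(a : ℚ); 0, 1], by
    have : (p : ℚ) ≠ 0 := by exact_mod_cast (Fact.out : p.Prime).ne_zero
    simp [this]⟩

/-- The matrix `(0, -1; 1, -b_l) ⋯ (0, -1; 1, -b₀)` of the `∞`-adic reduction. -/
def matQ : List ℤ → Matrix.SpecialLinearGroup (Fin 2) ℚ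
  | [] => 1
  | b :: bs => matQ bs * ⟨!![0, -1; 1, -(b : ℚ)], by simp⟩

namespace Expansion

/-- The matrix `A = (Q P D)⁻¹` of a loop. -/
def matA (p : ℕ) [Fact p.Prime] (E : Expansion) (k : ℕ) : Matrix.SpecialLinearGroup (Fin 2) ℚ :=
  (matQ (E.b k) * matP p (E.a k) * matD (E.δ k))⁻¹

/-- The product `B_N` of the matrices `A` of the first `N` loops. -/
def matB (p : ℕ) [Fact p.Prime] (E : Expansion) : ℕ → Matrix.SpecialLinearGroup (Fin 2) ℚ
  | 0 => 1
  | N + 1 => matB p E N * matA p E N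

end Expansion

end PCF

end

noncomputable section

namespace PCF

/-! ### The ring of integers `ℤ[θ]` -/

/-- The trace of `θ`. -/
def thetaTr (d : ℕ) : ℤ := if -(d : ℤ) ≡ 1 [ZMOD 4] then -1 else 0

/-- The norm of `θ`. -/
def thetaNm (d : ℕ) : ℤ := if -(d : ℤ) ≡ 1 [ZMOD 4] then (1 + d) / 4 else d

theorem theta_sq (d : ℕ) : theta d ^ 2 = thetaTr d * theta d - thetaNm d := by
  unfold theta thetaTr thetaNm
  split_ifs with h
  · obtain ⟨k, hk⟩ : (4 : ℤ) ∣ 1 + d := by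
      have := h.dvd
      rwa [sub_neg_eq_add] at this
    have h1 : ((1 + d : ℤ) / 4 : ℤ) = k := by omega
    have h2 : (d : ℂ) = 4 * k - 1 := by
      have : ((1 + d : ℤ) : ℂ) = ((4 * k : ℤ) : ℂ) := by rw [hk]
      push_cast at this
      linear_combination this
    rw [h1]
    have := sqrtNeg_sq d
    rw [h2] at this
    push_cast
    linear_combination this / 4
  · rw [sqrtNeg_sq]; push_cast; ring

theorem sqrtNeg_re (d : ℕ) : (sqrtNeg d).re = 0 := by simp [sqrtNeg]

theorem sqrtNeg_im (d : ℕ) : (sqrtNeg d).im = √d := by simp [sqrtNeg]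

theorem conj_sqrtNeg (d : ℕ) : (starRingEnd ℂ) (sqrtNeg d) = -sqrtNeg d := by
  simp [sqrtNeg]

theorem theta_im_pos {d : ℕ} (hd : 0 < d) : 0 < (theta d).im := by
  have : 0 < √(d : ℝ) := Real.sqrt_pos.2 (by exact_mod_cast hd)
  unfold theta
  split_ifs
  · simp [sqrtNeg_im]; exact_mod_cast hd
  · rwa [sqrtNeg_im]

theorem conj_theta (d : ℕ) : (starRingEnd ℂ) (theta d) = thetaTr d - theta d := by
  unfold theta thetaTr
  split_ifs
  · simp [conj_sqrtNeg, Complex.conj_ofNat]; ring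
  · simp [conj_sqrtNeg]

/-- `z` lies in `ℤ[θ]`. -/
def IsInt (d : ℕ) (z : ℂ) : Prop := ∃ m n : ℤ, z = m * theta d + n

variable {d : ℕ} {z w : ℂ}

theorem IsInt.intCast (n : ℤ) : IsInt d n := ⟨0, n, by simp⟩

theorem IsInt.natCast (n : ℕ) : IsInt d n := ⟨0, n, by simp⟩

theorem isInt_theta : IsInt d (theta d) := ⟨1, 0, by simp⟩

theorem IsInt.add (hz : IsInt d z) (hw : IsInt d w) : IsInt d (z + w) := by
  obtain ⟨a, b, rfl⟩ := hz
  obtain ⟨a', b', rfl⟩ := hw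
  exact ⟨a + a', b + b', by push_cast; ring⟩

theorem IsInt.mul (hz : IsInt d z) (hw : IsInt d w) : IsInt d (z * w) := by
  obtain ⟨a, b, rfl⟩ := hz
  obtain ⟨a', b', rfl⟩ := hw
  exact ⟨a * a' * thetaTr d + a * b' + a' * b, b * b' - a * a' * thetaNm d, by
    push_cast; linear_combination (a * a' : ℂ) * theta_sq d⟩

theorem IsInt.neg (hz : IsInt d z) : IsInt d (-z) := by
  simpa using (IsInt.intCast (-1)).mul hz

theorem IsInt.sub (hz : IsInt d z) (hw : IsInt d w) : IsInt d (z - w) := by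
  rw [sub_eq_add_neg]; exact hz.add hw.neg

theorem IsInt.conj (hz : IsInt d z) : IsInt d ((starRingEnd ℂ) z) := by
  obtain ⟨a, b, rfl⟩ := hz
  exact ⟨-a, a * thetaTr d + b, by simp [conj_theta]; ring⟩

theorem exists_sqrtNeg_eq (d : ℕ) : ∃ m n : ℤ, sqrtNeg d = m * theta d + n := by
  unfold theta
  split_ifs
  · exact ⟨2, 1, by push_cast; ring⟩
  · exact ⟨1, 0, by simp⟩

theorem exists_of_mem_F (hz : z ∈ F d) : ∃ a b : ℚ, z = a * sqrtNeg d + b := by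
  have halg : IsAlgebraic ℚ (sqrtNeg d) := by
    refine ⟨Polynomial.X ^ 2 + Polynomial.C (d : ℚ),
      (Polynomial.monic_X_pow_add_C _ two_ne_zero).ne_zero, ?_⟩
    simp [sqrtNeg_sq]
  have h : z ∈ Algebra.adjoin ℚ {sqrtNeg d} := by
    rwa [← IntermediateField.adjoin_simple_toSubalgebra_of_isAlgebraic halg]
  induction h using Algebra.adjoin_induction with
  | mem x hx => rw [Set.mem_singleton_iff.1 hx]; exact ⟨1, 0, by simp⟩
  | algebraMap r => exact ⟨0, r, by simp⟩
  | add x y hx hy h1 h2 =>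
    have hF : ∀ t ∈ Algebra.adjoin ℚ {sqrtNeg d}, t ∈ F d := fun t ht => by
      rwa [← IntermediateField.adjoin_simple_toSubalgebra_of_isAlgebraic halg] at ht
    obtain ⟨a, b, rfl⟩ := h1 (hF _ hx)
    obtain ⟨a', b', rfl⟩ := h2 (hF _ hy)
    exact ⟨a + a', b + b', by push_cast; ring⟩
  | mul x y hx hy h1 h2 =>
    have hF : ∀ t ∈ Algebra.adjoin ℚ {sqrtNeg d}, t ∈ F d := fun t ht => by
      rwa [← IntermediateField.adjoin_simple_toSubalgebra_of_isAlgebraic halg] at ht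
    obtain ⟨a, b, rfl⟩ := h1 (hF _ hx)
    obtain ⟨a', b', rfl⟩ := h2 (hF _ hy)
    exact ⟨a * b' + a' * b, b * b' - a * a' * d, by
      push_cast; linear_combination (a * a' : ℂ) * sqrtNeg_sq d⟩

theorem sqrtNeg_mem (d : ℕ) : sqrtNeg d ∈ F d :=
  IntermediateField.mem_adjoin_simple_self ℚ _

theorem theta_mem (d : ℕ) : theta d ∈ F d := by
  unfold theta
  split_ifs
  · exact div_mem (add_mem (neg_mem (one_mem _)) (sqrtNeg_mem d)) (ofNat_mem _ 2)
  · exact sqrtNeg_mem d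

theorem isIntegral_theta (d : ℕ) : IsIntegral ℤ (theta d) := by
  refine ⟨Polynomial.X ^ 2 - (Polynomial.C (thetaTr d) * Polynomial.X - Polynomial.C (thetaNm d)),
    ?_, ?_⟩
  · apply Polynomial.monic_X_pow_sub
    refine lt_of_le_of_lt (b := (1 : WithBot ℕ)) (by compute_degree) (by norm_num)
  · have h1 : ((thetaTr d : ℤ) : Polynomial ℤ) = Polynomial.C (thetaTr d) := by simp
    have h2 : ((thetaNm d : ℤ) : Polynomial ℤ) = Polynomial.C (thetaNm d) := by simp
    simp only [Polynomial.eval₂_sub, Polynomial.eval₂_mul, Polynomial.eval₂_C,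
      Polynomial.eval₂_X, Polynomial.eval₂_pow, theta_sq]
    simp

theorem exists_int_of_isIntegral_ratCast {q : ℚ} (h : IsIntegral ℤ (q : ℂ)) : ∃ n : ℤ, q = n := by
  have h1 : IsIntegral ℤ q :=
    (isIntegral_algebraMap_iff (A := ℚ) (B := ℂ) (algebraMap ℚ ℂ).injective).1 (by simpa using h)
  obtain ⟨n, hn⟩ := IsIntegrallyClosed.isIntegral_iff.1 h1
  exact ⟨n, by simpa using hn.symm⟩

theorem exists_int_of_sq_mul_squarefree (hd : Squarefree d) {q : ℚ} {k : ℤ}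
    (h : q ^ 2 * d = k) : ∃ n : ℤ, q = n := by
  have hden : (q.den : ℚ) ≠ 0 := by exact_mod_cast q.den_nz
  have h1 : (q.num : ℤ) ^ 2 * d = k * (q.den : ℤ) ^ 2 := by
    have : (q.num : ℚ) ^ 2 * d = k * (q.den : ℚ) ^ 2 := by
      rw [← h]
      nth_rewrite 2 [← Rat.num_div_den q]
      field_simp
    exact_mod_cast this
  have hc : IsCoprime ((q.den : ℤ) ^ 2) (q.num ^ 2) := by
    apply IsCoprime.pow
    rw [Int.isCoprime_iff_gcd_eq_one, Int.gcd_comm]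
    simpa [Int.gcd] using q.reduced
  have h2 : ((q.den : ℤ) ^ 2) ∣ (d : ℤ) := hc.dvd_of_dvd_mul_left ⟨k, h1.trans (mul_comm _ _)⟩
  have h3 : q.den * q.den ∣ d := by rw [← sq]; exact_mod_cast h2
  have h4 : q.den = 1 := by simpa using hd _ h3
  exact ⟨q.num, by rw [← Rat.num_div_den q]; simp [h4]⟩

theorem isInt_of_isIntegral (hd : Squarefree d) (hF : z ∈ F d) (h : IsIntegral ℤ z) :
    IsInt d z := by
  obtain ⟨a, b, rfl⟩ := exists_of_mem_F hF
  have hconj : IsIntegral ℤ ((starRingEnd ℂ) (a * sqrtNeg d + b)) :=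
    map_isIntegral_int (starRingEnd ℂ) h
  have hc : (starRingEnd ℂ) (a * sqrtNeg d + b) = -a * sqrtNeg d + b := by
    simp [conj_sqrtNeg]
  rw [hc] at hconj
  obtain ⟨B, hB⟩ : ∃ n : ℤ, 2 * b = n := by
    apply exists_int_of_isIntegral_ratCast
    have e : ((2 * b : ℚ) : ℂ) = (a * sqrtNeg d + b) + (-a * sqrtNeg d + b) := by
      push_cast; ring
    exact e ▸ h.add hconj
  obtain ⟨N, hN⟩ : ∃ n : ℤ, b ^ 2 + a ^ 2 * d = n := by
    apply exists_int_of_isIntegral_ratCast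
    have e : ((b ^ 2 + a ^ 2 * d : ℚ) : ℂ) =
        (a * sqrtNeg d + b) * (-a * sqrtNeg d + b) := by
      push_cast; linear_combination (a ^ 2 : ℂ) * sqrtNeg_sq d
    exact e ▸ h.mul hconj
  obtain ⟨A, hA⟩ : ∃ n : ℤ, 2 * a = n := by
    apply exists_int_of_sq_mul_squarefree hd (k := 4 * N - B ^ 2)
    push_cast
    rw [← hN, ← hB]; ring
  have hAB : B ^ 2 + A ^ 2 * d = 4 * N := by
    have : (B : ℚ) ^ 2 + A ^ 2 * d = 4 * N := by rw [← hA, ← hB, ← hN]; ring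
    exact_mod_cast this
  have ha : (a : ℂ) = A / 2 := by
    have : a = A / 2 := by rw [← hA]; ring
    rw [this]; push_cast; ring
  have hb : (b : ℂ) = B / 2 := by
    have : b = B / 2 := by rw [← hB]; ring
    rw [this]; push_cast; ring
  rw [ha, hb]
  have h4 : d % 4 ≠ 0 := by
    intro h0
    have := hd 2 (by norm_num; omega)
    simp at this
  obtain ⟨e, he⟩ : ∃ e : ℤ, (d : ℤ) = 4 * e + (d % 4 : ℕ) := ⟨d / 4, by omega⟩
  unfold IsInt theta
  split_ifs with hmod
  · have h3 : d % 4 = 3 := by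
      have := hmod.dvd
      omega
    rw [he, h3] at hAB
    obtain ⟨A', rfl | rfl⟩ := Int.even_or_odd' A <;> obtain ⟨B', rfl | rfl⟩ := Int.even_or_odd' B
    · exact ⟨2 * A', A' + B', by push_cast; ring⟩
    · exfalso; ring_nf at hAB; omega
    · exfalso; ring_nf at hAB; omega
    · exact ⟨2 * A' + 1, A' + B' + 1, by push_cast; ring⟩
  · have h12 : d % 4 = 1 ∨ d % 4 = 2 := by
      have h3 : d % 4 ≠ 3 := by
        intro h3
        apply hmod
        rw [Int.modEq_iff_dvd]
        omega
      omega
    obtain ⟨A', rfl | rfl⟩ := Int.even_or_odd' A <;> obtain ⟨B', rfl | rfl⟩ := Int.even_or_odd' B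
    · exact ⟨A', B', by push_cast; ring⟩
    all_goals
      exfalso
      rcases h12 with h12 | h12 <;> rw [he, h12] at hAB <;> ring_nf at hAB <;>
        omega

theorem IsInt.mem_F (hz : IsInt d z) : z ∈ F d := by
  obtain ⟨m, n, rfl⟩ := hz
  exact add_mem (mul_mem (intCast_mem _ m) (theta_mem d)) (intCast_mem _ n)

theorem IsInt.exists_integer (hz : IsInt d z) : ∃ x : 𝓞 (F d), ((x : F d) : ℂ) = z := by
  have hF := hz.mem_F
  obtain ⟨m, n, rfl⟩ := hz
  have hi : IsIntegral ℤ ((m : ℂ) * theta d + n) := by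
    refine IsIntegral.add (IsIntegral.mul ?_ (isIntegral_theta d)) ?_
    · simpa using isIntegral_algebraMap (R := ℤ) (A := ℂ) (x := m)
    · simpa using isIntegral_algebraMap (R := ℤ) (A := ℂ) (x := n)
  have h2 : IsIntegral ℤ (⟨_, hF⟩ : F d) :=
    (isIntegral_algebraMap_iff (R := ℤ) (A := F d) (B := ℂ) (algebraMap (F d) ℂ).injective).1 hi
  exact ⟨⟨_, h2⟩, rfl⟩

theorem isInt_coe (hd : Squarefree d) (x : 𝓞 (F d)) : IsInt d ((x : F d) : ℂ) :=
  isInt_of_isIntegral hd (x : F d).2 ((x.isIntegral_coe).map 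
    (algebraMap (F d) ℂ).toIntAlgHom)

theorem theta_coeff_eq {R : Type*} [Field R] [CharZero R] [Algebra R ℝ] (hd : 0 < d) {a b a' b' : R}
    (h : (algebraMap R ℝ a : ℂ) * theta d + (algebraMap R ℝ b : ℂ) =
      (algebraMap R ℝ a' : ℂ) * theta d + (algebraMap R ℝ b' : ℂ)) : a = a' ∧ b = b' := by
  have hp := theta_im_pos hd
  have him := congrArg Complex.im h
  simp only [Complex.add_im, Complex.mul_im, Complex.ofReal_re, Complex.ofReal_im, zero_mul,
    add_zero] at him
  have h1 : a = a' := (algebraMap R ℝ).injective (mul_right_cancel₀ hp.ne' him)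
  subst h1
  exact ⟨rfl, (algebraMap R ℝ).injective (Complex.ofReal_injective (add_left_cancel h))⟩

theorem theta_coeff_eq_rat (hd : 0 < d) {a b a' b' : ℚ}
    (h : (a : ℂ) * theta d + b = a' * theta d + b') : a = a' ∧ b = b' :=
  theta_coeff_eq hd (by simpa using h)

theorem theta_coeff_eq_int (hd : 0 < d) {a b a' b' : ℤ}
    (h : (a : ℂ) * theta d + b = a' * theta d + b') : a = a' ∧ b = b' := by
  have := theta_coeff_eq_rat hd (a := a) (b := b) (a' := a') (b' := b') (by simpa using h)
  exact_mod_cast this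

/-- A basis of `F` over `ℚ`. -/
def thetaBasis (hd : 0 < d) : Module.Basis (Fin 2) ℚ (F d) :=
  Module.Basis.mk (v := ![⟨theta d, theta_mem d⟩, 1])
    (by
      rw [LinearIndependent.pair_iff]
      intro s t h
      have h' : (s : ℂ) * theta d + t = (0 : ℚ) * theta d + (0 : ℚ) := by
        have := congrArg (Subtype.val : F d → ℂ) h
        simpa [Algebra.smul_def] using this
      exact theta_coeff_eq_rat hd h')
    (by
      rintro ⟨z, hz⟩ -
      obtain ⟨a, b, rfl⟩ := exists_of_mem_F hz
      obtain ⟨m, n, hmn⟩ := exists_sqrtNeg_eq d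
      rw [Matrix.range_cons, Matrix.range_cons, Matrix.range_empty, Set.union_empty,
        Set.singleton_union, Submodule.mem_span_pair]
      refine ⟨a * m, a * n + b, Subtype.ext ?_⟩
      simp [Algebra.smul_def, hmn]; ring)

theorem finrank_F (hd : 0 < d) : Module.finrank ℚ (F d) = 2 := by
  rw [Module.finrank_eq_card_basis (thetaBasis hd), Fintype.card_fin]

theorem exists_theta_coord (hz : z ∈ F d) : ∃ a b : ℚ, z = a * theta d + b := by
  obtain ⟨a, b, rfl⟩ := exists_of_mem_F hz
  obtain ⟨m, n, hmn⟩ := exists_sqrtNeg_eq d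
  exact ⟨a * m, a * n + b, by rw [hmn]; push_cast; ring⟩

theorem norm_eq_mul_conj (hd : 0 < d) (x : F d) :
    ((Algebra.norm ℚ x : ℚ) : ℂ) = (x : ℂ) * (starRingEnd ℂ) (x : ℂ) := by
  obtain ⟨a, b, hab⟩ := exists_theta_coord x.2
  have h0 : thetaBasis hd 0 = ⟨theta d, theta_mem d⟩ := by simp [thetaBasis]
  have h1 : thetaBasis hd 1 = 1 := by simp [thetaBasis]
  have e0 : x * thetaBasis hd 0 = (a * thetaTr d + b) • thetaBasis hd 0 +
      (-a * thetaNm d) • thetaBasis hd 1 := by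
    rw [h0, h1]
    apply Subtype.ext
    simp [Algebra.smul_def, hab]
    linear_combination (a : ℂ) * theta_sq d
  have e1 : x * thetaBasis hd 1 = a • thetaBasis hd 0 + b • thetaBasis hd 1 := by
    rw [h0, h1]
    apply Subtype.ext
    simp [Algebra.smul_def, hab]
  rw [Algebra.norm_eq_matrix_det (thetaBasis hd), Matrix.det_fin_two]
  simp only [Algebra.leftMulMatrix_eq_repr_mul, e0, e1]
  simp [hab, conj_theta]
  linear_combination (a ^ 2 : ℂ) * theta_sq d

end PCF

namespace PCF

variable {p : ℕ} [Fact p.Prime] {d : ℕ} {z w : ℂ}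

/-! ### The split prime -/

theorem exists_simple_root (hd : Squarefree d) (hp : SplitsCompletely p (F d)) :
    ∃ g : ℤ, (p : ℤ) ∣ g ^ 2 - thetaTr d * g + thetaNm d ∧ ¬ (p : ℤ) ∣ 2 * g - thetaTr d := by
  have hd0 : 0 < d := Nat.pos_of_ne_zero hd.ne_zero
  have hprime : Prime (p : ℤ) := Nat.prime_iff_prime_int.1 Fact.out
  unfold SplitsCompletely at hp
  rw [finrank_F hd0, Set.ncard_eq_two] at hp
  obtain ⟨P, Q, hPQ, hS⟩ := hp
  have key : ∀ P ∈ (Ideal.span {(p : ℤ)}).primesOver (𝓞 (F d)),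
      P.IsPrime ∧ ∀ n : ℤ, (n : 𝓞 (F d)) ∈ P ↔ (p : ℤ) ∣ n := by
    rintro P ⟨h1, h2⟩
    refine ⟨h1, fun n => ?_⟩
    rw [← Ideal.mem_span_singleton, h2.over, Ideal.mem_comap]
    simp
  obtain ⟨hPp, hPz⟩ := key P (by rw [hS]; simp)
  obtain ⟨hQp, hQz⟩ := key Q (by rw [hS]; simp)
  have hle : ¬ P ≤ Q := by
    intro hle
    have hP0 : P ≠ ⊥ := by
      intro h
      have h1 := (hPz p).2 dvd_rfl
      rw [h, Ideal.mem_bot] at h1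
      exact (Fact.out : p.Prime).ne_zero (by exact_mod_cast h1)
    exact hPQ ((hPp.isMaximal hP0).eq_of_le hQp.ne_top hle)
  obtain ⟨r, hrP, hrQ⟩ := Set.not_subset.1 hle
  obtain ⟨m, n, hmn⟩ := isInt_coe hd r
  obtain ⟨t, ht⟩ := (isInt_theta (d := d)).exists_integer
  have hr : r = m * t + n := by
    apply NumberField.RingOfIntegers.ext
    apply Subtype.ext
    simp [ht, hmn]
  have htt : t ^ 2 = thetaTr d * t - thetaNm d := by
    apply NumberField.RingOfIntegers.ext
    apply Subtype.ext
    simp [ht, theta_sq]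
  have hpm : ¬ (p : ℤ) ∣ m := by
    intro hm
    have h1 := (hPz m).2 hm
    have h2 : (n : 𝓞 (F d)) ∈ P := by
      have : (n : 𝓞 (F d)) = r - m * t := by rw [hr]; ring
      rw [this]
      exact P.sub_mem hrP (P.mul_mem_right _ h1)
    exact hrQ (hr ▸ Q.add_mem (Q.mul_mem_right _ ((hQz m).2 hm)) ((hQz n).2 ((hPz n).1 h2)))
  obtain ⟨a, b, hab⟩ : IsCoprime m (p : ℤ) := ((Prime.coprime_iff_not_dvd hprime).2 hpm).symm
  have hab' : (a : 𝓞 (F d)) * m = 1 - b * p := by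
    have : ((a * m + b * p : ℤ) : 𝓞 (F d)) = 1 := by rw [hab]; simp
    push_cast at this
    linear_combination this
  set g : ℤ := -(a * n) with hg
  have hbp : ∀ P : Ideal (𝓞 (F d)), ((p : ℤ) : 𝓞 (F d)) ∈ P → ∀ x : 𝓞 (F d), x * p ∈ P :=
    fun P hP x => P.mul_mem_left _ (by simpa using hP)
  have hpP := (hPz p).2 dvd_rfl
  have hpQ := (hQz p).2 dvd_rfl
  have htP : t - g ∈ P := by
    have : t - g = a * r + (b * t) * p := by
      rw [hr, hg]; push_cast; linear_combination (-t) * hab'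
    rw [this]
    exact P.add_mem (P.mul_mem_left _ hrP) (hbp P hpP _)
  have htQ : t - g ∉ Q := by
    intro h
    apply hrQ
    have : r = m * (t - g) + (b * n) * p := by
      rw [hr, hg]; push_cast; linear_combination -(n : 𝓞 (F d)) * hab'
    rw [this]
    exact Q.add_mem (Q.mul_mem_left _ h) (hbp Q hpQ _)
  have hfac : ((g ^ 2 - thetaTr d * g + thetaNm d : ℤ) : 𝓞 (F d)) =
      (t - g) * (thetaTr d - t - g) := by
    push_cast; linear_combination htt
  have hdvd : (p : ℤ) ∣ g ^ 2 - thetaTr d * g + thetaNm d := by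
    rw [← hPz, hfac]
    exact P.mul_mem_right _ htP
  refine ⟨g, hdvd, fun h2 => htQ ?_⟩
  have h3 : (thetaTr d - t - g : 𝓞 (F d)) ∈ Q := by
    have h4 := (hQz _).2 hdvd
    rw [hfac] at h4
    exact (hQp.mem_or_mem h4).resolve_left htQ
  have h5 : t - g = -(thetaTr d - t - g) - ((2 * g - thetaTr d : ℤ) : 𝓞 (F d)) := by
    push_cast; ring
  rw [h5]
  exact Q.sub_mem (Q.neg_mem h3) ((hQz _).2 h2)

/-- `ι` maps `θ` to a `p`-adic integer at which the derivative of the minimal polynomial of `θ` is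
a unit. -/
def IsSplitAt (ι : ℂ ≃+* PadicAlgCl p) (d : ℕ) : Prop :=
  ∃ c : ℤ_[p], ι (theta d) = algebraMap ℚ_[p] (PadicAlgCl p) (c : ℚ_[p]) ∧
    ‖2 * c - (thetaTr d : ℤ_[p])‖ = 1

theorem isSplitAt_of_splitsCompletely (ι : ℂ ≃+* PadicAlgCl p) (hd : Squarefree d)
    (hp : SplitsCompletely p (F d)) : IsSplitAt ι d := by
  obtain ⟨g, hg1, hg2⟩ := exists_simple_root hd hp
  let f : Polynomial ℤ := Polynomial.X ^ 2 - Polynomial.C (thetaTr d) * Polynomial.X +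
    Polynomial.C (thetaNm d)
  have hf : ∀ c : ℤ_[p], Polynomial.aeval c f = c ^ 2 - thetaTr d * c + thetaNm d := by
    intro c; simp [f]
  have hf' : ∀ c : ℤ_[p], Polynomial.aeval c (Polynomial.derivative f) = 2 * c - thetaTr d := by
    intro c
    simp only [f, Polynomial.derivative_add, Polynomial.derivative_sub,
      Polynomial.derivative_X_pow, Polynomial.derivative_C_mul, Polynomial.derivative_X,
      Polynomial.derivative_C]
    simp
    exact .inl (map_ofNat (Polynomial.aeval c) 2)
  have hn1 : ‖2 * (g : ℤ_[p]) - thetaTr d‖ = 1 := by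
    have : (2 * (g : ℤ_[p]) - thetaTr d) = ((2 * g - thetaTr d : ℤ) : ℤ_[p]) := by push_cast; rfl
    rw [this]
    refine le_antisymm (PadicInt.norm_le_one _) (not_lt.1 fun h => hg2 ?_)
    exact (PadicInt.norm_int_lt_one_iff_dvd _).1 h
  have hn2 : ‖(g : ℤ_[p]) ^ 2 - thetaTr d * g + thetaNm d‖ < 1 := by
    have : (g : ℤ_[p]) ^ 2 - thetaTr d * g + thetaNm d =
      ((g ^ 2 - thetaTr d * g + thetaNm d : ℤ) : ℤ_[p]) := by push_cast; rfl
    rw [this]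
    exact (PadicInt.norm_int_lt_one_iff_dvd _).2 hg1
  obtain ⟨c, hc1, -, hc3, -⟩ := hensels_lemma (p := p) (F := f) (a := (g : ℤ_[p])) (by
    rw [hf, hf', hn1]; simpa using hn2)
  rw [hf] at hc1
  rw [hf', hf', hn1] at hc3
  let e : ℤ_[p] →+* PadicAlgCl p :=
    (algebraMap ℚ_[p] (PadicAlgCl p)).comp PadicInt.Coe.ringHom
  have h1 := congrArg e hc1
  have h2 := congrArg ι (theta_sq d)
  simp only [map_add, map_sub, map_mul, map_pow, map_intCast, map_zero] at h1 h2
  have h3 : (ι (theta d) - e c) * (ι (theta d) - e (thetaTr d - c)) = 0 := by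
    simp only [map_sub, map_intCast]
    linear_combination h2 - h1
  rcases mul_eq_zero.1 h3 with h | h
  · exact ⟨c, sub_eq_zero.1 h, hc3⟩
  · refine ⟨thetaTr d - c, sub_eq_zero.1 h, ?_⟩
    rw [← hc3, ← norm_neg]
    congr 1; ring

variable {ι : ℂ ≃+* PadicAlgCl p}

theorem inZp_iff : InZp ι z ↔
    ι z ∈ (algebraMap ℚ_[p] (PadicAlgCl p)).fieldRange ∧ ‖ι z‖ ≤ 1 := by
  constructor
  · rintro ⟨c, hc⟩
    refine ⟨⟨c, hc.symm⟩, ?_⟩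
    rw [hc, PadicAlgCl.norm_extends]
    exact c.2
  · rintro ⟨⟨q, hq⟩, h⟩
    rw [← hq, PadicAlgCl.norm_extends] at h
    exact ⟨⟨q, h⟩, hq.symm⟩

theorem norm_intCast (n : ℤ) : ‖ι n‖ = ‖(n : ℚ_[p])‖ := by
  rw [map_intCast, ← PadicAlgCl.norm_extends, map_intCast]

theorem norm_natCast_pow (n : ℕ) : ‖ι ((p : ℂ) ^ n)‖ = (p : ℝ) ^ (-n : ℤ) := by
  rw [← Nat.cast_pow, map_natCast, ← Padic.norm_p_pow, ← PadicAlgCl.norm_extends]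
  simp

theorem norm_natCast_self : ‖ι (p : ℂ)‖ = (p : ℝ) ^ (-1 : ℤ) := by
  simpa using norm_natCast_pow (ι := ι) 1

theorem norm_intCast_le_iff (m : ℤ) (n : ℕ) :
    ‖ι m‖ ≤ (p : ℝ) ^ (-n : ℤ) ↔ (p : ℤ) ^ n ∣ m := by
  rw [norm_intCast, Padic.norm_int_le_pow_iff_dvd]

theorem norm_intCast_le_one (m : ℤ) : ‖ι m‖ ≤ 1 := by
  rw [norm_intCast]; exact Padic.norm_int_le_one m

theorem norm_map_add_le {b : ℝ} (hz : ‖ι z‖ ≤ b) (hw : ‖ι w‖ ≤ b) : ‖ι (z + w)‖ ≤ b := by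
  rw [map_add]
  exact (IsUltrametricDist.norm_add_le_max _ _).trans (max_le hz hw)

theorem norm_map_sub_le {b : ℝ} (hz : ‖ι z‖ ≤ b) (hw : ‖ι w‖ ≤ b) : ‖ι (z - w)‖ ≤ b := by
  rw [sub_eq_add_neg]
  exact norm_map_add_le hz (by rwa [map_neg, norm_neg])

theorem norm_map_mul_le {a b : ℝ} (hz : ‖ι z‖ ≤ a) (hw : ‖ι w‖ ≤ b) : ‖ι (z * w)‖ ≤ a * b := by
  rw [map_mul, norm_mul]
  exact mul_le_mul hz hw (norm_nonneg _) ((norm_nonneg _).trans hz)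

theorem one_lt_p : (1 : ℝ) < p := by exact_mod_cast (Fact.out : p.Prime).one_lt

theorem p_pos : (0 : ℝ) < p := zero_lt_one.trans one_lt_p

theorem zpow_neg_le_one (n : ℕ) : (p : ℝ) ^ (-n : ℤ) ≤ 1 :=
  zpow_le_one_of_nonpos₀ one_lt_p.le (by simp)

theorem p_ne_zero : (p : ℂ) ≠ 0 := by exact_mod_cast (Fact.out : p.Prime).ne_zero

theorem norm_le_inv_of_lt_one (hz : ι z ∈ (algebraMap ℚ_[p] (PadicAlgCl p)).fieldRange)
    (h : ‖ι z‖ < 1) : ‖ι z‖ ≤ (p : ℝ) ^ (-1 : ℤ) := by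
  obtain ⟨q, hq⟩ := hz
  rw [← hq, PadicAlgCl.norm_extends] at h ⊢
  rw [Padic.norm_le_pow_iff_norm_lt_pow_add_one]
  simpa using h

theorem isPrime_primeAbove (ι : ℂ ≃+* PadicAlgCl p) (d : ℕ) : (primeAbove ι d).IsPrime := by
  constructor
  · rw [Ideal.ne_top_iff_one]
    intro h1
    have : ‖ι (((1 : 𝓞 (F d)) : F d) : ℂ)‖ < 1 := h1
    simp at this
  · intro x y hxy
    by_contra! hc
    have h1 : ¬ ‖ι ((x : F d) : ℂ)‖ < 1 := hc.1
    have h2 : ¬ ‖ι ((y : F d) : ℂ)‖ < 1 := hc.2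
    have h3 : ‖ι (((x * y : 𝓞 (F d)) : F d) : ℂ)‖ < 1 := hxy
    simp only [map_mul, IntermediateField.coe_mul, norm_mul] at h3
    nlinarith

namespace IsSplitAt

theorem inZp (h : IsSplitAt ι d) (hz : IsInt d z) : InZp ι z := by
  obtain ⟨c, hc, -⟩ := h
  obtain ⟨m, n, rfl⟩ := hz
  exact ⟨m * c + n, by simp [hc]⟩

theorem norm_le_one (h : IsSplitAt ι d) (hz : IsInt d z) : ‖ι z‖ ≤ 1 :=
  (inZp_iff.1 (h.inZp hz)).2

theorem mem_fieldRange (h : IsSplitAt ι d) (hz : IsInt d z) :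
    ι z ∈ (algebraMap ℚ_[p] (PadicAlgCl p)).fieldRange :=
  (inZp_iff.1 (h.inZp hz)).1

theorem norm_sub_conj (h : IsSplitAt ι d) : ‖ι (2 * theta d - thetaTr d)‖ = 1 := by
  obtain ⟨c, hc, hc1⟩ := h
  rw [← hc1, PadicInt.norm_def, ← PadicAlgCl.norm_extends]
  have h2 : ((2 : ℤ_[p]) : ℚ_[p]) = 2 := rfl
  simp [hc, h2, map_ofNat]

/-- An element of `ℤ[θ]` that is divisible by `p ^ n` at both places above `p` is divisible by
`p ^ n`. -/
theorem exists_eq_pow_mul (h : IsSplitAt ι d) (hz : IsInt d z) {n : ℕ}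
    (h1 : ‖ι z‖ ≤ (p : ℝ) ^ (-n : ℤ)) (h2 : ‖ι ((starRingEnd ℂ) z)‖ ≤ (p : ℝ) ^ (-n : ℤ)) :
    ∃ w, IsInt d w ∧ z = (p : ℂ) ^ n * w := by
  obtain ⟨a, b, rfl⟩ := hz
  have h3 := norm_map_sub_le h1 h2
  have e : (a : ℂ) * theta d + b - (starRingEnd ℂ) (a * theta d + b) =
      a * (2 * theta d - thetaTr d) := by simp [conj_theta]; ring
  rw [e, map_mul, norm_mul, h.norm_sub_conj, mul_one] at h3
  have h4 := norm_map_sub_le h1 (w := a * theta d) (by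
    have := norm_map_mul_le h3 (h.norm_le_one isInt_theta)
    rwa [mul_one] at this)
  rw [add_sub_cancel_left, norm_intCast_le_iff] at h4
  rw [norm_intCast_le_iff] at h3
  obtain ⟨a', rfl⟩ := h3
  obtain ⟨b', rfl⟩ := h4
  exact ⟨a' * theta d + b', ⟨a', b', rfl⟩, by push_cast; ring⟩

theorem exists_norm_sub_le (h : IsSplitAt ι d) (n : ℕ) :
    ∃ g : ℤ, ‖ι (theta d - g)‖ ≤ (p : ℝ) ^ (-n : ℤ) := by
  obtain ⟨c, hc, -⟩ := h
  refine ⟨c.appr n, ?_⟩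
  have h1 := (PadicInt.norm_le_pow_iff_mem_span_pow _ n).2 (PadicInt.appr_spec n c)
  rw [PadicInt.norm_def, ← PadicAlgCl.norm_extends] at h1
  simpa [hc] using h1

theorem norm_conj_sub (h : IsSplitAt ι d) {g : ℤ} (hg : ‖ι (theta d - g)‖ < 1) :
    ‖ι ((starRingEnd ℂ) (theta d - g))‖ = 1 := by
  have e : (starRingEnd ℂ) (theta d - g) = (theta d - g) + -(2 * theta d - thetaTr d) := by
    simp [conj_theta]; ring
  rw [e, map_add, IsUltrametricDist.norm_add_eq_max_of_norm_ne_norm, map_neg, norm_neg,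
    h.norm_sub_conj]
  · exact max_eq_right hg.le
  · rw [map_neg, norm_neg, h.norm_sub_conj]; exact hg.ne

theorem mem_primeAbove_pow (h : IsSplitAt ι d) (hd : Squarefree d) (n : ℕ) (x : 𝓞 (F d)) :
    x ∈ primeAbove ι d ^ n ↔ ‖ι ((x : F d) : ℂ)‖ ≤ (p : ℝ) ^ (-n : ℤ) := by
  have hmem : ∀ x : 𝓞 (F d), x ∈ primeAbove ι d ↔ ‖ι ((x : F d) : ℂ)‖ < 1 := fun _ => Iff.rfl
  constructor
  · intro hx
    induction n generalizing x with
    | zero => simpa using h.norm_le_one (isInt_coe hd x)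
    | succ n ih =>
      rw [pow_succ] at hx
      induction hx using Submodule.mul_induction_on' with
      | mem_mul_mem a ha b hb =>
        have h1 := norm_le_inv_of_lt_one (h.mem_fieldRange (isInt_coe hd b)) ((hmem b).1 hb)
        have h2 := norm_map_mul_le (ih a ha) h1
        rw [← zpow_add₀ p_pos.ne'] at h2
        simpa [add_comm] using h2
      | add a _ b _ h1 h2 => simpa using norm_map_add_le h1 h2
  · have := isPrime_primeAbove ι d
    obtain ⟨g, hg⟩ := h.exists_norm_sub_le 1
    have hg1 : ‖ι (theta d - g)‖ < 1 := hg.trans_lt (by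
      simpa using inv_lt_one_of_one_lt₀ (one_lt_p (p := p)))
    have hgi : IsInt d (theta d - g) := isInt_theta.sub (.intCast g)
    obtain ⟨j, hj⟩ := hgi.conj.exists_integer
    have hjP : j ∉ primeAbove ι d := by
      rw [hmem, hj, h.norm_conj_sub hg1]; simp
    intro hx
    induction n generalizing x with
    | zero => simp
    | succ n ih =>
      have hxj : IsInt d ((x : F d) * (starRingEnd ℂ) (theta d - g)) :=
        (isInt_coe hd x).mul hgi.conj
      have hx1 : ‖ι ((x : F d) : ℂ)‖ ≤ (p : ℝ) ^ (-1 : ℤ) :=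
        hx.trans (zpow_le_zpow_right₀ one_lt_p.le (by simp))
      obtain ⟨w, hw, hwx⟩ := h.exists_eq_pow_mul (n := 1) hxj
        (by simpa using norm_map_mul_le hx1 (h.norm_le_one hgi.conj))
        (by
          rw [map_mul, Complex.conj_conj]
          simpa using norm_map_mul_le (h.norm_le_one (isInt_coe hd x).conj) hg)
      obtain ⟨y, rfl⟩ := hw.exists_integer
      have hy : ‖ι ((y : F d) : ℂ)‖ ≤ (p : ℝ) ^ (-n : ℤ) := by
        have h1 := norm_map_mul_le hx (h.norm_le_one hgi.conj)
        rw [hwx, map_mul, norm_mul, norm_natCast_pow, mul_one] at h1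
        have h2 : (p : ℝ) ^ (-(n + 1 : ℕ) : ℤ) = (p : ℝ) ^ (-(1 : ℕ) : ℤ) * (p : ℝ) ^ (-n : ℤ) := by
          rw [← zpow_add₀ p_pos.ne']; congr 1; push_cast; ring
        rw [h2] at h1
        exact le_of_mul_le_mul_left h1 (zpow_pos p_pos _)
      have hjx : j * x = p * y := by
        apply NumberField.RingOfIntegers.ext
        apply Subtype.ext
        simp [hj, mul_comm _ ((x : F d) : ℂ)]
        simpa using hwx
      have hpP : (p : 𝓞 (F d)) ∈ primeAbove ι d := by
        rw [hmem]
        simpa using (norm_natCast_self (ι := ι)).trans_lt (by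
          simpa using inv_lt_one_of_one_lt₀ (one_lt_p (p := p)))
      have h3 : j * x ∈ primeAbove ι d ^ (n + 1) := by
        rw [hjx, pow_succ']
        exact Ideal.mul_mem_mul hpP (ih y hy)
      exact (Ideal.IsPrime.mul_mem_pow _ h3).resolve_left hjP

end IsSplitAt

end PCF

namespace PCF

/-! ### The fundamental domain -/

theorem mem_fundDomain_iff {z : ℂ} : z ∈ fundDomain ↔
    0 < z.im ∧ -1 / 2 ≤ z.re ∧ z.re < 1 / 2 ∧
      (1 < Complex.normSq z ∨ Complex.normSq z = 1 ∧ z.re ≤ 0) := by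
  have hnorm : ∀ z : ℂ, 1 < ‖z‖ ↔ 1 < Complex.normSq z := fun z => by
    rw [Complex.normSq_eq_norm_sq, one_lt_sq_iff₀ (norm_nonneg z)]
  constructor
  · rintro (⟨h1, h2, h3, h4⟩ | ⟨φ, h1, h2, rfl⟩)
    · exact ⟨h1, h3, h4, .inl ((hnorm z).1 h2)⟩
    · have hpi := Real.pi_pos
      have hcos : Real.cos (2 * Real.pi / 3) = -1 / 2 := by
        rw [show 2 * Real.pi / 3 = Real.pi - Real.pi / 3 by ring, Real.cos_pi_sub,
          Real.cos_pi_div_three]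
        ring
      have hle : Real.cos (2 * Real.pi / 3) ≤ Real.cos φ :=
        Real.cos_le_cos_of_nonneg_of_le_pi (by linarith) (by linarith) h2
      have hre : Real.cos φ ≤ 0 := Real.cos_nonpos_of_pi_div_two_le_of_le h1 (by linarith)
      have hnz : ‖Complex.exp (φ * Complex.I)‖ = 1 := Complex.norm_exp_ofReal_mul_I φ
      rw [Complex.exp_ofReal_mul_I_re, Complex.exp_ofReal_mul_I_im, Complex.normSq_eq_norm_sq, hnz]
      refine ⟨Real.sin_pos_of_pos_of_lt_pi (by linarith) (by linarith), by linarith, by linarith,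
        .inr ⟨by norm_num, hre⟩⟩
  · rintro ⟨h1, h2, h3, h4 | ⟨h4, h5⟩⟩
    · exact .inl ⟨h1, (hnorm z).2 h4, h2, h3⟩
    · refine .inr ⟨Real.arccos z.re, ?_, ?_, ?_⟩
      · rw [← Real.arccos_zero]; exact Real.arccos_le_arccos h5
      · have hcos : Real.cos (2 * Real.pi / 3) = -1 / 2 := by
          rw [show 2 * Real.pi / 3 = Real.pi - Real.pi / 3 by ring, Real.cos_pi_sub,
            Real.cos_pi_div_three]
          ring
        have hpi := Real.pi_pos
        rw [← Real.arccos_cos (x := 2 * Real.pi / 3) (by linarith) (by linarith), hcos]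
        exact Real.arccos_le_arccos h2
      · rw [Complex.normSq_apply] at h4
        apply Complex.ext
        · rw [Complex.exp_ofReal_mul_I_re, Real.cos_arccos (by linarith) (by linarith)]
        · rw [Complex.exp_ofReal_mul_I_im, Real.sin_arccos,
            show 1 - z.re ^ 2 = z.im ^ 2 by linarith, Real.sqrt_sq h1.le]

theorem int_form_pos {m n : ℤ} (h : m ≠ 0 ∨ n ≠ 0) : 1 ≤ m ^ 2 - |m * n| + n ^ 2 := by
  have h1 : 0 < m ^ 2 + n ^ 2 := by
    rcases h with h | h
    · have := sq_pos_of_ne_zero h; positivity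
    · have := sq_pos_of_ne_zero h; positivity
  have h2 : 0 < 2 * (m ^ 2 - |m * n| + n ^ 2) := by
    rcases abs_cases (m * n) with ⟨h, -⟩ | ⟨h, -⟩ <;> rw [h] <;>
      nlinarith [sq_nonneg (m - n), sq_nonneg (m + n)]
  omega

theorem normSq_lattice_ge {y : ℂ} (hy : y ∈ fundDomain) {m n : ℤ} (h : m ≠ 0 ∨ n ≠ 0) :
    1 + (m : ℝ) ^ 2 * (Complex.normSq y - 1) ≤ Complex.normSq (m * y + n) := by
  obtain ⟨-, h2, h3, -⟩ := mem_fundDomain_iff.1 hy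
  have h5 : (1 : ℝ) ≤ (m : ℝ) ^ 2 - |(m : ℝ) * n| + (n : ℝ) ^ 2 := by
    exact_mod_cast int_form_pos h
  have h6 : Complex.normSq (m * y + n) =
      (m : ℝ) ^ 2 * Complex.normSq y + 2 * (m * n) * y.re + (n : ℝ) ^ 2 := by
    simp [Complex.normSq_apply]; ring
  have h7 : -|(m : ℝ) * n| ≤ 2 * (m * n) * y.re := by
    rcases abs_cases ((m : ℝ) * n) with ⟨h, h'⟩ | ⟨h, h'⟩ <;> rw [h] <;> nlinarith
  rw [h6]
  linarith

theorem one_le_normSq {y : ℂ} (hy : y ∈ fundDomain) : 1 ≤ Complex.normSq y := by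
  obtain ⟨-, -, -, h | h⟩ := mem_fundDomain_iff.1 hy
  · exact h.le
  · exact h.1.ge

theorem int_coeff_eq {y : ℂ} (hy : 0 < y.im) {a b a' b' : ℤ}
    (h : (a : ℂ) * y + b = a' * y + b') : a = a' ∧ b = b' := by
  have him := congrArg Complex.im h
  simp at him
  have h1 : a = a' := him.resolve_right hy.ne'
  subst h1
  exact ⟨rfl, by exact_mod_cast add_left_cancel h⟩

theorem im_eq_det_mul {x y c : ℂ} {a b m n : ℤ} (h1 : c * x = a * y + b) (h2 : c = m * y + n) :
    x.im * Complex.normSq c = (a * n - b * m) * y.im := by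
  have h3 : x * (Complex.normSq c : ℂ) = (a * y + b) * (starRingEnd ℂ) (m * y + n) := by
    rw [← Complex.mul_conj, ← h1, ← h2]; ring
  have h4 := congrArg Complex.im h3
  simp at h4
  rw [h4]; ring

/-- Points of the fundamental domain are determined by the homothety class of the lattice that they
span together with `1`. -/
theorem eq_of_lattice_eq {x y c : ℂ} (hx : x ∈ fundDomain) (hy : y ∈ fundDomain)
    (h : ∀ v : ℂ, (∃ m n : ℤ, v = c * (m * x + n)) ↔ ∃ m n : ℤ, v = m * y + n) : x = y := by
  obtain ⟨hx1, hx2, hx3, hx4⟩ := mem_fundDomain_iff.1 hx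
  obtain ⟨hy1, hy2, hy3, hy4⟩ := mem_fundDomain_iff.1 hy
  obtain ⟨a, b, h1⟩ := (h (c * x)).1 ⟨1, 0, by simp⟩
  obtain ⟨m, n, h2⟩ := (h c).1 ⟨0, 1, by simp⟩
  obtain ⟨a', b', h3⟩ := (h y).2 ⟨1, 0, by simp⟩
  obtain ⟨m', n', h4⟩ := (h 1).2 ⟨0, 1, by simp⟩
  have e1 : ((1 : ℤ) : ℂ) * y + (0 : ℤ) = ((a' * a + b' * m : ℤ) : ℂ) * y + (a' * b + b' * n : ℤ) := by
    push_cast; linear_combination h3 + (a' : ℂ) * h1 + (b' : ℂ) * h2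
  have e2 : ((0 : ℤ) : ℂ) * y + (1 : ℤ) = ((m' * a + n' * m : ℤ) : ℂ) * y + (m' * b + n' * n : ℤ) := by
    push_cast; linear_combination h4 + (m' : ℂ) * h1 + (n' : ℂ) * h2
  obtain ⟨e11, e12⟩ := int_coeff_eq hy1 e1
  obtain ⟨e21, e22⟩ := int_coeff_eq hy1 e2
  have hdet : (a * n - b * m) * (a' * n' - b' * m') = 1 := by
    linear_combination -e11 * (m' * b + n' * n) - e22 + e21 * (a' * b + b' * n)
  have hc0 : c ≠ 0 := by rintro rfl; simp at h4
  have hcpos : 0 < Complex.normSq c := Complex.normSq_pos.2 hc0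
  have him := im_eq_det_mul h1 h2
  have hdet1 : a * n - b * m = 1 := by
    have hpos : 0 < a * n - b * m := by
      have : (0 : ℝ) < a * n - b * m := by
        by_contra! hle
        have h5 := mul_pos hx1 hcpos
        rw [him] at h5
        nlinarith
      exact_mod_cast this
    rcases Int.isUnit_iff.1 (IsUnit.of_mul_eq_one _ hdet) with h | h <;> omega
  rw [hdet1, one_mul] at hdet
  have hm' : m' = -m := by linear_combination (-m') * hdet1 - n * e21 + m * e22
  have him1 : x.im * Complex.normSq c = y.im := by
    rw [him]
    have : (a * n - b * m : ℝ) = 1 := by exact_mod_cast hdet1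
    rw [this, one_mul]
  have hmn : m ≠ 0 ∨ n ≠ 0 := by
    by_contra! h0
    rw [h0.1, h0.2] at hdet1
    simp at hdet1
  have hmn' : m' ≠ 0 ∨ n' ≠ 0 := by
    by_contra! h0
    rw [h0.1, h0.2] at hdet
    simp at hdet
  have g1 := normSq_lattice_ge hy hmn
  have g2 := normSq_lattice_ge hx hmn'
  have hcc : Complex.normSq c * Complex.normSq (m' * x + n') = 1 := by
    rw [← Complex.normSq_mul, ← h4]; simp
  have n1 := one_le_normSq hy
  have n2 := one_le_normSq hx
  rw [← h2] at g1
  have hm2 : 0 ≤ (m : ℝ) ^ 2 * (Complex.normSq y - 1) := by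
    have : 0 ≤ Complex.normSq y - 1 := by linarith
    positivity
  have hm2' : 0 ≤ (m' : ℝ) ^ 2 * (Complex.normSq x - 1) := by
    have : 0 ≤ Complex.normSq x - 1 := by linarith
    positivity
  have hc1 : Complex.normSq c = 1 := by nlinarith
  rw [hc1, one_mul] at hcc
  rw [hc1, mul_one] at him1
  rw [hc1] at g1
  rw [hcc] at g2
  by_cases hm : m = 0
  · subst hm
    have hre : (x.re : ℝ) = y.re + (b * n : ℤ) := by
      have hn2 : (n : ℂ) * n = 1 := by
        have hd : a * n = 1 := by simpa using hdet1
        have : n * n = 1 := by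
          rcases Int.isUnit_iff.1 (IsUnit.of_mul_eq_one_right _ hd) with h | h <;> rw [h] <;> rfl
        exact_mod_cast this
      have han : (a : ℂ) * n = 1 := by
        have hd : a * n = 1 := by simpa using hdet1
        exact_mod_cast hd
      have hxy : x = y + ((b * n : ℤ) : ℂ) := by
        push_cast at h2 ⊢
        rw [h2] at h1
        linear_combination (n : ℂ) * h1 - x * hn2 + y * han
      simpa using congrArg Complex.re hxy
    have h0 : b * n = 0 := by
      have k1 : ((b * n : ℤ) : ℝ) < 1 := by linarith
      have k2 : (-1 : ℝ) < ((b * n : ℤ) : ℝ) := by linarith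
      have k3 : b * n < 1 := by exact_mod_cast k1
      have k4 : -1 < b * n := by exact_mod_cast k2
      omega
    rw [h0] at hre
    exact Complex.ext (by simpa using hre) him1
  · have hmpos : 0 < (m : ℝ) ^ 2 := by positivity
    have ny : Complex.normSq y = 1 := by nlinarith
    have nx : Complex.normSq x = 1 := by
      have hmm : (m' : ℝ) ^ 2 = (m : ℝ) ^ 2 := by rw [hm']; push_cast; ring
      rw [hmm] at g2
      nlinarith
    have rx : x.re ≤ 0 := by rcases hx4 with h | h; exacts [absurd nx h.ne', h.2]
    have ry : y.re ≤ 0 := by rcases hy4 with h | h; exacts [absurd ny h.ne', h.2]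
    rw [Complex.normSq_apply] at nx ny
    have hsq : x.re ^ 2 = y.re ^ 2 := by rw [him1] at nx; linarith
    refine Complex.ext ?_ him1
    rcases sq_eq_sq_iff_eq_or_eq_neg.1 hsq with h | h
    · exact h
    · linarith

theorem theta_mem_fundDomain {d : ℕ} (hd : 0 < d) : theta d ∈ fundDomain := by
  rw [mem_fundDomain_iff]
  refine ⟨theta_im_pos hd, ?_⟩
  have hs : √(d : ℝ) * √(d : ℝ) = d := Real.mul_self_sqrt (by positivity)
  unfold theta
  split_ifs with h
  · have h3 : (3 : ℝ) ≤ d := by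
      have := h.dvd
      have : 3 ≤ d := by omega
      exact_mod_cast this
    have hre : ((-1 + sqrtNeg d) / 2).re = -1 / 2 := by simp [sqrtNeg_re]
    have hn : Complex.normSq ((-1 + sqrtNeg d) / 2) = (1 + d) / 4 := by
      rw [Complex.normSq_div, Complex.normSq_apply]
      simp [sqrtNeg_re, sqrtNeg_im]
      norm_num
    rw [hre, hn]
    refine ⟨by norm_num, by norm_num, ?_⟩
    rcases h3.eq_or_lt with h | h
    · exact .inr ⟨by rw [← h]; norm_num, by norm_num⟩
    · exact .inl (by linarith)
  · have h1 : (1 : ℝ) ≤ d := by exact_mod_cast hd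
    have hn : Complex.normSq (sqrtNeg d) = d := by
      rw [Complex.normSq_apply]
      simp [sqrtNeg_re, sqrtNeg_im]
    rw [sqrtNeg_re, hn]
    refine ⟨by norm_num, by norm_num, ?_⟩
    rcases h1.eq_or_lt with h | h
    · exact .inr ⟨h.symm, le_rfl⟩
    · exact .inl h

/-! ### The `∞`-adic reduction -/

theorem exp_pi_div_three :
    Complex.exp (Real.pi / 3 * Complex.I) = ⟨1 / 2, √3 / 2⟩ := by
  rw [← Complex.ofReal_ofNat, ← Complex.ofReal_div]
  apply Complex.ext
  · rw [Complex.exp_ofReal_mul_I_re, Real.cos_pi_div_three]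
  · rw [Complex.exp_ofReal_mul_I_im, Real.sin_pi_div_three]

theorem IsDigit.unique {z : ℂ} {b b' : ℤ} (h : IsDigit z b) (h' : IsDigit z b') : b = b' := by
  rcases h with ⟨h0, h1, h2⟩ | ⟨h0, rfl⟩ <;> rcases h' with ⟨h0', h1', h2'⟩ | ⟨h0', rfl⟩
  · simp at h1 h2 h1' h2'
    have k1 : (b : ℝ) < b' + 1 := by linarith
    have k2 : (b' : ℝ) < b + 1 := by linarith
    have k3 : b < b' + 1 := by exact_mod_cast k1
    have k4 : b' < b + 1 := by exact_mod_cast k2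
    omega
  · exact absurd h0' h0
  · exact absurd h0 h0'
  · rfl

theorem IsInftyReduction.unique {z : ℂ} {bs bs' : List ℤ} {w w' : ℂ}
    (h : IsInftyReduction z bs w) (h' : IsInftyReduction z bs' w') : bs = bs' ∧ w = w' := by
  induction bs generalizing z bs' with
  | nil =>
    cases bs' with
    | nil => exact ⟨rfl, h.2.trans h'.2.symm⟩
    | cons b' bs' => exact absurd h.1 h'.1
  | cons b bs ih =>
    cases bs' with
    | nil => exact absurd h'.1 h.1
    | cons b' bs' =>
      obtain rfl := h.2.1.unique h'.2.1
      obtain ⟨rfl, rfl⟩ := ih h.2.2 h'.2.2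
      exact ⟨rfl, rfl⟩

theorem neg_one_div_im (w : ℂ) : (-1 / w).im = w.im / Complex.normSq w := by
  rw [neg_div, one_div, Complex.neg_im, Complex.inv_im]; ring

theorem neg_one_div_re (w : ℂ) : (-1 / w).re = -w.re / Complex.normSq w := by
  rw [neg_div, one_div, Complex.neg_re, Complex.inv_re]; ring

theorem ne_zero_of_im_pos {w : ℂ} (h : 0 < w.im) : w ≠ 0 := by
  rintro rfl; simp at h

theorem neg_one_div_im_pos {w : ℂ} (h : 0 < w.im) : 0 < (-1 / w).im := by
  rw [neg_one_div_im]
  exact div_pos h (Complex.normSq_pos.2 (ne_zero_of_im_pos h))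

/-- The reduction of `-1 / w` when `w` lies in the closed fundamental strip outside the open unit
disc. -/
theorem exists_reduction_neg_one_div {w : ℂ} (h0 : 0 < w.im) (h1 : -1 / 2 ≤ w.re)
    (h2 : w.re < 1 / 2) (h3 : 1 ≤ Complex.normSq w) :
    ∃ bs w', IsInftyReduction (-1 / w) bs w' := by
  by_cases hy : -1 / w ∈ fundDomain
  · exact ⟨[], _, hy, rfl⟩
  have hw0 := ne_zero_of_im_pos h0
  have hw : w ∈ fundDomain := by
    rw [mem_fundDomain_iff]
    refine ⟨h0, h1, h2, ?_⟩
    rcases h3.eq_or_lt with h | h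
    · refine .inr ⟨h.symm, ?_⟩
      by_contra! hpos
      apply hy
      rw [mem_fundDomain_iff, neg_one_div_re, neg_one_div_im, Complex.normSq_div, ← h]
      simp
      exact ⟨h0, by linarith, by linarith, hpos.le⟩
    · exact .inl h
  have hinv : -1 / (-1 / w - ((0 : ℤ) : ℂ)) = w := by
    field_simp; simp
  refine ⟨[0], w, hy, ?_, by rw [hinv]; exact ⟨hw, rfl⟩⟩
  by_cases he : -1 / w = Complex.exp (Real.pi / 3 * Complex.I)
  · exact .inr ⟨he, rfl⟩
  refine .inl ⟨he, ?_⟩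
  rw [Int.cast_zero, sub_zero, neg_one_div_re]
  have hN : 0 < Complex.normSq w := by linarith
  rw [le_div_iff₀ hN, div_lt_iff₀ hN]
  refine ⟨by linarith, ?_⟩
  by_contra! hle
  have hre : w.re = -1 / 2 := by linarith
  have hNw : Complex.normSq w = 1 := by linarith
  apply he
  rw [exp_pi_div_three]
  apply Complex.ext
  · rw [neg_one_div_re, hNw, hre]; norm_num
  · rw [neg_one_div_im, hNw]
    rw [Complex.normSq_apply, hre] at hNw
    have : w.im = √3 / 2 := by
      have h4 : (2 * w.im) ^ 2 = 3 := by linarith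
      rw [← h4, Real.sqrt_sq (by linarith)]; ring
    simpa using this

/-- `ℤ z + ℤ` is stable under multiplication by `θ`. -/
def IsStable (d : ℕ) (z : ℂ) : Prop :=
  (∃ a b : ℤ, theta d = a * z + b) ∧ ∃ a b : ℤ, theta d * z = a * z + b

theorem IsStable.sub_int {d : ℕ} {z : ℂ} (h : IsStable d z) (k : ℤ) : IsStable d (z - k) := by
  obtain ⟨⟨a, b, h1⟩, a', b', h2⟩ := h
  exact ⟨⟨a, a * k + b, by rw [h1]; push_cast; ring⟩,
    ⟨a' - a * k, a' * k - a * k * k + b' - b * k, by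
      push_cast; linear_combination h2 - (k : ℂ) * h1⟩⟩

theorem IsStable.neg_one_div {d : ℕ} {z : ℂ} (hz : z ≠ 0) (h : IsStable d z) :
    IsStable d (-1 / z) := by
  obtain ⟨⟨a, b, h1⟩, a', b', h2⟩ := h
  refine ⟨⟨-b', a', ?_⟩, ⟨b, -a, ?_⟩⟩
  · field_simp; push_cast; linear_combination h2
  · field_simp; push_cast; linear_combination -h1

theorem IsStable.exists_nat {d : ℕ} {z : ℂ} (hd : 0 < d) (hz : 0 < z.im) (h : IsStable d z) :
    ∃ n : ℕ, 0 < n ∧ (theta d).im = n * z.im := by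
  obtain ⟨⟨a, b, h1⟩, -⟩ := h
  have h2 : (theta d).im = a * z.im := by simpa using congrArg Complex.im h1
  have h3 : 0 < a := by
    have h4 := theta_im_pos hd
    rw [h2] at h4
    exact_mod_cast pos_of_mul_pos_left h4 hz.le
  lift a to ℕ using h3.le
  exact ⟨a, by exact_mod_cast h3, by exact_mod_cast h2⟩

theorem exists_reduction {d : ℕ} (hd : 0 < d) {z : ℂ} (hz : 0 < z.im) (h : IsStable d z) :
    ∃ bs w, IsInftyReduction z bs w := by
  obtain ⟨n, hn0, hn⟩ := h.exists_nat hd hz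
  induction n using Nat.strong_induction_on generalizing z with
  | _ n ih =>
  by_cases hzD : z ∈ fundDomain
  · exact ⟨[], z, hzD, rfl⟩
  suffices hs : ∃ b : ℤ, IsDigit z b ∧ ∃ bs w, IsInftyReduction (-1 / (z - b)) bs w by
    obtain ⟨b, hb, bs, w, hbs⟩ := hs
    exact ⟨b :: bs, w, hzD, hb, hbs⟩
  by_cases he : z = Complex.exp (Real.pi / 3 * Complex.I)
  · refine ⟨0, .inr ⟨he, rfl⟩, [], _, ?_, rfl⟩
    rw [exp_pi_div_three] at he
    have h3 : √3 * √3 = (3 : ℝ) := Real.mul_self_sqrt (by norm_num)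
    have hN : Complex.normSq z = 1 := by
      rw [he, Complex.normSq_mk]; linarith
    have hre : z.re = 1 / 2 := by rw [he]
    rw [Int.cast_zero, sub_zero, mem_fundDomain_iff, neg_one_div_re, neg_one_div_im,
      Complex.normSq_div, hN, hre]
    norm_num [hz]
  · set b : ℤ := ⌊z.re + 1 / 2⌋ with hb
    have hb1 := Int.floor_le (z.re + 1 / 2)
    have hb2 := Int.lt_floor_add_one (z.re + 1 / 2)
    rw [← hb] at hb1 hb2
    have hre : (z - b).re = z.re - b := by simp
    have him : (z - b).im = z.im := by simp
    have h1 : -1 / 2 ≤ (z - b).re := by rw [hre]; linarith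
    have h2 : (z - b).re < 1 / 2 := by rw [hre]; linarith
    refine ⟨b, .inl ⟨he, h1, h2⟩, ?_⟩
    have hw : 0 < (z - b).im := by rwa [him]
    rcases le_or_gt 1 (Complex.normSq (z - b)) with hN | hN
    · exact exists_reduction_neg_one_div hw h1 h2 hN
    · have hst := (h.sub_int b).neg_one_div (ne_zero_of_im_pos hw)
      have hpos := neg_one_div_im_pos hw
      obtain ⟨n', hn0', hn'⟩ := hst.exists_nat hd hpos
      refine ih n' ?_ hpos hst hn0' hn'
      rw [neg_one_div_im, him] at hn'
      have hNpos : 0 < Complex.normSq (z - b) := Complex.normSq_pos.2 (ne_zero_of_im_pos hw)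
      rw [hn] at hn'
      field_simp at hn'
      have : (n' : ℝ) < n := by
        rw [← hn']
        exact mul_lt_of_lt_one_right (by exact_mod_cast hn0) hN
      exact_mod_cast this

/-! ### The action of matrices -/

/-- `g` sends the column vector `(x, 1)` to `l` times the column vector `(y, 1)`. -/
def Sends (g : Matrix.SpecialLinearGroup (Fin 2) ℚ) (x y l : ℂ) : Prop :=
  (g 0 0 : ℂ) * x + (g 0 1 : ℂ) = l * y ∧ (g 1 0 : ℂ) * x + (g 1 1 : ℂ) = l

theorem Sends.mul {g h : Matrix.SpecialLinearGroup (Fin 2) ℚ} {x y z l m : ℂ}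
    (hg : Sends g y z m) (hh : Sends h x y l) : Sends (g * h) x z (l * m) := by
  obtain ⟨h1, h2⟩ := hg
  obtain ⟨h3, h4⟩ := hh
  constructor <;>
    simp only [Matrix.SpecialLinearGroup.coe_mul, Matrix.mul_apply, Fin.sum_univ_two] <;> push_cast
  · linear_combination (g 0 0 : ℂ) * h3 + (g 0 1 : ℂ) * h4 + l * h1
  · linear_combination (g 1 0 : ℂ) * h3 + (g 1 1 : ℂ) * h4 + l * h2

theorem sends_one (x : ℂ) : Sends 1 x x 1 := by simp [Sends]

theorem IsInftyReduction.mem {z w : ℂ} {bs : List ℤ} (h : IsInftyReduction z bs w) :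
    w ∈ fundDomain := by
  induction bs generalizing z with
  | nil => exact h.2 ▸ h.1
  | cons b bs ih => exact ih h.2.2

theorem IsInftyReduction.exists_sends {z w : ℂ} {bs : List ℤ} (h : IsInftyReduction z bs w)
    (hz : 0 < z.im) : ∃ l : ℂ, l ≠ 0 ∧ Sends (matQ bs) z w l ∧
      ∀ v : ℂ, (∃ m n : ℤ, v = m * z + n) ↔ ∃ m n : ℤ, v = l * (m * w + n) := by
  induction bs generalizing z with
  | nil => exact ⟨1, one_ne_zero, by rw [h.2]; exact sends_one z, by simp [h.2]⟩
  | cons b bs ih =>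
    have hw : 0 < (z - b).im := by simpa using hz
    have hw0 := ne_zero_of_im_pos hw
    obtain ⟨l, hl0, hl, hv⟩ := ih h.2.2 (neg_one_div_im_pos hw)
    refine ⟨(z - b) * l, mul_ne_zero hw0 hl0, hl.mul ?_, fun v => ?_⟩
    · constructor
      · simp
        field_simp
      · simp; ring
    · have h1 : (∃ m n : ℤ, v = m * z + n) ↔ ∃ m n : ℤ, v / (z - b) = m * (-1 / (z - b)) + n := by
        constructor
        · rintro ⟨m, n, rfl⟩
          exact ⟨-(m * b + n), m, by field_simp; push_cast; ring⟩
        · rintro ⟨m, n, hmn⟩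
          exact ⟨n, -m - n * b, by field_simp at hmn; rw [hmn]; push_cast; ring⟩
      rw [h1, hv]
      refine exists_congr fun m => exists_congr fun n => ?_
      rw [div_eq_iff hw0]
      constructor <;> rintro rfl <;> ring

end PCF

namespace PCF

variable {p : ℕ} [Fact p.Prime] {d : ℕ} {ι : ℂ ≃+* PadicAlgCl p}

/-! ### A loop of the algorithm -/

/-- `c (ℤ x + ℤ)` is the ideal `𝔭 ^ (2 k)` of `ℤ[θ]`. -/
def IsPowLattice (ι : ℂ ≃+* PadicAlgCl p) (d k : ℕ) (c x : ℂ) : Prop :=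
  ∀ v : ℂ, (∃ m n : ℤ, v = c * (m * x + n)) ↔
    IsInt d v ∧ ‖ι v‖ ≤ (p : ℝ) ^ (-(2 * k : ℕ) : ℤ)

/-- A loop of the algorithm, from `x` to `y`. -/
def IsLoop (ι : ℂ ≃+* PadicAlgCl p) (x : ℂ) (δ : ℤ) (a : ℕ) (bs : List ℤ) (y : ℂ) : Prop :=
  ((InZp ι x ∧ δ = 1) ∨ (¬ InZp ι x ∧ δ = -1)) ∧ a < p ^ 2 ∧
    InZp ι (((if δ = 1 then x else -1 / x) - a) / (p : ℂ) ^ 2) ∧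
    IsInftyReduction (((if δ = 1 then x else -1 / x) - a) / (p : ℂ) ^ 2) bs y

theorem isExpansionOf_iff {E : Expansion} {z : ℂ} :
    E.IsExpansionOf ι z ↔
      E.x 0 = z ∧ ∀ k, IsLoop ι (E.x k) (E.δ k) (E.a k) (E.b k) (E.x (k + 1)) :=
  ⟨fun h => ⟨h.start, fun k => ⟨h.sign k, h.digit_lt k, h.digit_congr k, h.reduction k⟩⟩,
    fun h => ⟨h.1, fun k => (h.2 k).1, fun k => (h.2 k).2.1, fun k => (h.2 k).2.2.1,
      fun k => (h.2 k).2.2.2⟩⟩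

theorem digit_unique {z : ℂ} {a a' : ℕ} (ha : a < p ^ 2) (ha' : a' < p ^ 2)
    (h : InZp ι ((z - a) / (p : ℂ) ^ 2)) (h' : InZp ι ((z - a') / (p : ℂ) ^ 2)) : a = a' := by
  have h1 := norm_map_sub_le (inZp_iff.1 h).2 (inZp_iff.1 h').2
  have hp1 : (p : ℂ) ≠ 0 := p_ne_zero
  have hp0 : (p : ℂ) ^ 2 ≠ 0 := pow_ne_zero _ hp1
  have h2 : ‖ι (((a' : ℤ) - (a : ℤ) : ℤ) : ℂ)‖ ≤ (p : ℝ) ^ (-(2 : ℕ) : ℤ) := by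
    have e : (((a' : ℤ) - (a : ℤ) : ℤ) : ℂ) =
        ((z - a) / (p : ℂ) ^ 2 - (z - a') / (p : ℂ) ^ 2) * (p : ℂ) ^ 2 := by
      field_simp; push_cast; ring
    rw [e]
    simpa using norm_map_mul_le h1 (norm_natCast_pow (ι := ι) 2).le
  rw [norm_intCast_le_iff] at h2
  have h3 : (a : ℤ) ≡ a' [ZMOD (p ^ 2 : ℕ)] := by
    rw [Int.modEq_iff_dvd]; exact_mod_cast h2
  exact Nat.ModEq.eq_of_lt_of_lt (Int.natCast_modEq_iff.1 h3) ha ha'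

theorem exists_digit {z : ℂ} (hz : InZp ι z) :
    ∃ a : ℕ, a < p ^ 2 ∧ InZp ι ((z - a) / (p : ℂ) ^ 2) := by
  obtain ⟨c, hc⟩ := hz
  refine ⟨c.appr 2, c.appr_lt 2, ?_⟩
  obtain ⟨y, hy⟩ := Ideal.mem_span_singleton.1 (PadicInt.appr_spec 2 c)
  refine ⟨y, ?_⟩
  have h1 : (c : ℚ_[p]) - (c.appr 2 : ℚ_[p]) = (p : ℚ_[p]) ^ 2 * y := by
    have := congrArg (Subtype.val : ℤ_[p] → ℚ_[p]) hy
    simpa using this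
  have hp0 : (p : PadicAlgCl p) ^ 2 ≠ 0 :=
    pow_ne_zero _ (by exact_mod_cast (Fact.out : p.Prime).ne_zero)
  have h2 := congrArg (algebraMap ℚ_[p] (PadicAlgCl p)) h1
  simp only [map_sub, map_mul, map_pow, map_natCast] at h2
  simp only [map_div₀, map_sub, map_pow, map_natCast, hc]
  rw [div_eq_iff hp0, h2]; ring

theorem IsLoop.unique {x y y' : ℂ} {δ δ' : ℤ} {a a' : ℕ} {bs bs' : List ℤ}
    (h : IsLoop ι x δ a bs y) (h' : IsLoop ι x δ' a' bs' y') :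
    δ = δ' ∧ a = a' ∧ bs = bs' ∧ y = y' := by
  obtain ⟨h1, h2, h3, h4⟩ := h
  obtain ⟨h1', h2', h3', h4'⟩ := h'
  obtain rfl : δ = δ' := by
    rcases h1 with ⟨h, rfl⟩ | ⟨h, rfl⟩ <;> rcases h1' with ⟨h', rfl⟩ | ⟨h', rfl⟩ <;>
      first | rfl | contradiction
  obtain rfl := digit_unique h2 h2' h3 h3'
  exact ⟨rfl, rfl, h4.unique h4'⟩

namespace IsPowLattice

variable {k : ℕ} {c x : ℂ}

theorem theta (h : IsSplitAt ι d) : IsPowLattice ι d 0 1 (theta d) := by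
  intro v
  have : (∃ m n : ℤ, v = 1 * (m * PCF.theta d + n)) ↔ IsInt d v := by simp [IsInt]
  rw [this]
  exact ⟨fun hv => ⟨hv, by simpa using h.norm_le_one hv⟩, And.left⟩

theorem mem_left (hL : IsPowLattice ι d k c x) :
    IsInt d c ∧ ‖ι c‖ ≤ (p : ℝ) ^ (-(2 * k : ℕ) : ℤ) :=
  (hL c).1 ⟨0, 1, by simp⟩

theorem mem_mul (hL : IsPowLattice ι d k c x) :
    IsInt d (c * x) ∧ ‖ι (c * x)‖ ≤ (p : ℝ) ^ (-(2 * k : ℕ) : ℤ) :=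
  (hL (c * x)).1 ⟨1, 0, by simp⟩

theorem exists_pow_eq (hL : IsPowLattice ι d k c x) :
    ∃ m n : ℤ, (p : ℂ) ^ (2 * k) = c * (m * x + n) :=
  (hL _).2 ⟨by exact_mod_cast IsInt.natCast (p ^ (2 * k)), (norm_natCast_pow _).le⟩

theorem ne_zero (hL : IsPowLattice ι d k c x) : c ≠ 0 := by
  rintro rfl
  obtain ⟨m, n, h⟩ := hL.exists_pow_eq
  rw [zero_mul] at h
  exact pow_ne_zero _ p_ne_zero h

theorem mem_fieldRange (hL : IsPowLattice ι d k c x) (h : IsSplitAt ι d) :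
    ι x ∈ (algebraMap ℚ_[p] (PadicAlgCl p)).fieldRange := by
  have h1 := div_mem (h.mem_fieldRange hL.mem_mul.1) (h.mem_fieldRange hL.mem_left.1)
  rwa [← map_div₀, mul_div_cancel_left₀ _ hL.ne_zero] at h1

theorem isStable (hL : IsPowLattice ι d k c x) (h : IsSplitAt ι d) : IsStable d x := by
  have hmul : ∀ v, IsInt d v ∧ ‖ι v‖ ≤ (p : ℝ) ^ (-(2 * k : ℕ) : ℤ) →
      ∃ m n : ℤ, PCF.theta d * v = c * (m * x + n) := fun v hv =>
    (hL _).2 ⟨isInt_theta.mul hv.1, by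
      simpa using norm_map_mul_le (h.norm_le_one isInt_theta) hv.2⟩
  obtain ⟨m, n, h1⟩ := hmul c hL.mem_left
  obtain ⟨m', n', h2⟩ := hmul (c * x) hL.mem_mul
  exact ⟨⟨m, n, mul_left_cancel₀ hL.ne_zero (by linear_combination h1)⟩,
    ⟨m', n', mul_left_cancel₀ hL.ne_zero (by linear_combination h2)⟩⟩

theorem congr {l y : ℂ} (hL : IsPowLattice ι d k c x)
    (h : ∀ v : ℂ, (∃ m n : ℤ, v = m * x + n) ↔ ∃ m n : ℤ, v = l * (m * y + n)) :
    IsPowLattice ι d k (c * l) y := by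
  intro v
  rw [← hL v]
  have hc := hL.ne_zero
  have h1 := h (v / c)
  simp only [div_eq_iff hc] at h1
  constructor
  · rintro ⟨m, n, e⟩
    obtain ⟨m', n', e'⟩ := h1.2 ⟨m, n, by rw [e]; ring⟩
    exact ⟨m', n', by rw [e']; ring⟩
  · rintro ⟨m, n, e⟩
    obtain ⟨m', n', e'⟩ := h1.1 ⟨m, n, by rw [e]; ring⟩
    exact ⟨m', n', by rw [e']; ring⟩

theorem normalize (hL : IsPowLattice ι d k c x) (h : IsSplitAt ι d) (hx : 0 < x.im) {δ : ℤ}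
    (hδ : (InZp ι x ∧ δ = 1) ∨ (¬ InZp ι x ∧ δ = -1)) :
    0 < (if δ = 1 then x else -1 / x).im ∧ InZp ι (if δ = 1 then x else -1 / x) ∧
      ∃ l, Sends (matD δ) x (if δ = 1 then x else -1 / x) l ∧
        IsPowLattice ι d k (c * l) (if δ = 1 then x else -1 / x) := by
  rcases hδ with ⟨hz, rfl⟩ | ⟨hz, rfl⟩
  · simp only [if_true]
    exact ⟨hx, hz, 1, by simpa [matD] using sends_one x, by simpa using hL⟩
  · have hx0 := ne_zero_of_im_pos hx
    rw [if_neg (by norm_num)]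
    refine ⟨neg_one_div_im_pos hx, ?_, x, ?_, hL.congr fun v => ?_⟩
    · have hF := hL.mem_fieldRange h
      rw [inZp_iff] at hz ⊢
      refine ⟨?_, ?_⟩
      · rw [map_div₀, map_neg, map_one]
        exact div_mem (neg_mem (one_mem _)) hF
      · have h1 : 1 < ‖ι x‖ := by
          by_contra! hle
          exact hz ⟨hF, hle⟩
        rw [map_div₀, map_neg, map_one, norm_div, norm_neg, norm_one]
        exact (div_le_one (by linarith)).2 h1.le
    · constructor
      · simp [matD]; field_simp
      · simp [matD]
    · constructor
      · rintro ⟨m, n, rfl⟩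
        exact ⟨-n, m, by field_simp; push_cast; ring⟩
      · rintro ⟨m, n, rfl⟩
        exact ⟨n, -m, by field_simp; push_cast; ring⟩

theorem norm_left (hL : IsPowLattice ι d k c x) (hx : InZp ι x) :
    ‖ι c‖ = (p : ℝ) ^ (-(2 * k : ℕ) : ℤ) := by
  refine le_antisymm hL.mem_left.2 ?_
  obtain ⟨m, n, h⟩ := hL.exists_pow_eq
  rw [← norm_natCast_pow (ι := ι), h]
  have h1 : ‖ι (m * x + n)‖ ≤ 1 := norm_map_add_le
    (by simpa using norm_map_mul_le (norm_intCast_le_one m) (inZp_iff.1 hx).2)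
    (norm_intCast_le_one n)
  simpa using norm_map_mul_le le_rfl h1

theorem pAdicReduction (hL : IsPowLattice ι d k c x) (hx : InZp ι x) {a : ℕ}
    (ha : InZp ι ((x - a) / (p : ℂ) ^ 2)) :
    IsPowLattice ι d (k + 1) (c * (p : ℂ) ^ 2) ((x - a) / (p : ℂ) ^ 2) := by
  intro v
  have hp1 : (p : ℂ) ≠ 0 := p_ne_zero
  have hp0 : (p : ℂ) ^ 2 ≠ 0 := pow_ne_zero _ hp1
  have hc := hL.norm_left hx
  have hxa : ‖ι (x - a)‖ ≤ (p : ℝ) ^ (-(2 : ℕ) : ℤ) := by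
    have h1 := norm_map_mul_le (inZp_iff.1 ha).2 (norm_natCast_pow (ι := ι) 2).le
    rwa [div_mul_cancel₀ _ hp0, one_mul] at h1
  have hexp : (p : ℝ) ^ (-(2 * (k + 1) : ℕ) : ℤ) =
      (p : ℝ) ^ (-(2 * k : ℕ) : ℤ) * (p : ℝ) ^ (-(2 : ℕ) : ℤ) := by
    rw [← zpow_add₀ p_pos.ne']; congr 1; push_cast; ring
  have hmx : ∀ m : ℤ, ‖ι (m * (x - a))‖ ≤ (p : ℝ) ^ (-(2 : ℕ) : ℤ) := fun m => by
    simpa using norm_map_mul_le (norm_intCast_le_one m) hxa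
  rw [hexp]
  constructor
  · rintro ⟨m, n, rfl⟩
    have e : c * (p : ℂ) ^ 2 * (m * ((x - a) / (p : ℂ) ^ 2) + n) =
        c * (m * (x - a) + ((p ^ 2 * n : ℤ) : ℂ)) := by
      field_simp; push_cast; ring
    rw [e]
    refine ⟨((hL _).1 ⟨m, p ^ 2 * n - m * a, by push_cast; ring⟩).1, ?_⟩
    exact norm_map_mul_le hc.le (norm_map_add_le (hmx m) ((norm_intCast_le_iff _ 2).2 ⟨n, rfl⟩))
  · rintro ⟨hv1, hv2⟩
    obtain ⟨m, n, rfl⟩ := (hL v).2 ⟨hv1, hv2.trans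
      (mul_le_of_le_one_right (zpow_nonneg p_pos.le _) (zpow_neg_le_one 2))⟩
    rw [map_mul, norm_mul, hc] at hv2
    have h1 := norm_map_sub_le (le_of_mul_le_mul_left hv2 (zpow_pos p_pos _)) (hmx m)
    have e : (m * x + n - m * (x - a) : ℂ) = ((n + m * a : ℤ) : ℂ) := by push_cast; ring
    rw [e, norm_intCast_le_iff] at h1
    obtain ⟨n', hn'⟩ := h1
    have hn : (n : ℂ) = p ^ 2 * n' - m * a := by
      have : n = p ^ 2 * n' - m * a := by linarith
      rw [this]; push_cast; ring
    exact ⟨m, n', by rw [hn]; field_simp; ring⟩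

theorem sends_matP (x : ℂ) (a : ℕ) : Sends (matP p a) x ((x - a) / (p : ℂ) ^ 2) p := by
  have hp0 : (p : ℂ) ≠ 0 := p_ne_zero
  constructor <;> simp [matP]
  field_simp; ring

theorem loop (hL : IsPowLattice ι d k c x) (h : IsSplitAt ι d) (hx : 0 < x.im) {δ : ℤ} {a : ℕ}
    {bs : List ℤ} {y : ℂ} (hloop : IsLoop ι x δ a bs y) :
    ∃ l, Sends (matQ bs * matP p a * matD δ) x y l ∧ IsPowLattice ι d (k + 1) (c * (l * p)) y := by
  obtain ⟨h1, -, h3, h4⟩ := hloop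
  obtain ⟨hz1, hz2, l, hl, hL1⟩ := hL.normalize h hx h1
  have hL2 := hL1.pAdicReduction hz2 h3
  have him : 0 < (((if δ = 1 then x else -1 / x) - a) / (p : ℂ) ^ 2).im := by
    rw [← Nat.cast_pow, Complex.div_natCast_im]
    have : (0 : ℝ) < (p ^ 2 : ℕ) := by exact_mod_cast pow_pos (Fact.out : p.Prime).pos 2
    simpa using div_pos hz1 this
  obtain ⟨l', -, hl', hv⟩ := h4.exists_sends him
  refine ⟨l * (p * l'), ?_, ?_⟩
  · rw [mul_assoc]
    exact (mul_assoc l (p : ℂ) l') ▸ hl'.mul ((sends_matP _ a).mul hl)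
  · have := hL2.congr hv
    convert this using 1
    ring

theorem exists_loop (hL : IsPowLattice ι d k c x) (h : IsSplitAt ι d) (hd : 0 < d)
    (hx : 0 < x.im) : ∃ δ a bs y, IsLoop ι x δ a bs y := by
  obtain ⟨δ, hδ⟩ : ∃ δ : ℤ, (InZp ι x ∧ δ = 1) ∨ (¬ InZp ι x ∧ δ = -1) := by
    by_cases hz : InZp ι x
    · exact ⟨1, .inl ⟨hz, rfl⟩⟩
    · exact ⟨-1, .inr ⟨hz, rfl⟩⟩
  obtain ⟨hz1, hz2, l, hl, hL1⟩ := hL.normalize h hx hδ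
  obtain ⟨a, ha1, ha2⟩ := exists_digit hz2
  have him : 0 < (((if δ = 1 then x else -1 / x) - a) / (p : ℂ) ^ 2).im := by
    rw [← Nat.cast_pow, Complex.div_natCast_im]
    have : (0 : ℝ) < (p ^ 2 : ℕ) := by exact_mod_cast pow_pos (Fact.out : p.Prime).pos 2
    simpa using div_pos hz1 this
  obtain ⟨bs, y, hy⟩ := exists_reduction hd him ((hL1.pAdicReduction hz2 ha2).isStable h)
  exact ⟨δ, a, bs, y, hδ, ha1, ha2, hy⟩

end IsPowLattice

theorem im_pos_of_mem_fundDomain {x : ℂ} (hx : x ∈ fundDomain) : 0 < x.im :=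
  (mem_fundDomain_iff.1 hx).1

/-! ### Existence and uniqueness of the expansion -/

namespace Expansion.IsExpansionOf

variable {E : Expansion}

theorem exists_isPowLattice (hE : E.IsExpansionOf ι (theta d)) (h : IsSplitAt ι d) (hd : 0 < d)
    (k : ℕ) : E.x k ∈ fundDomain ∧ ∃ l, Sends (E.matB p k)⁻¹ (theta d) (E.x k) l ∧
      IsPowLattice ι d k ((p : ℂ) ^ k * l) (E.x k) := by
  obtain ⟨h0, hloop⟩ := isExpansionOf_iff.1 hE
  induction k with
  | zero =>
    rw [h0]
    refine ⟨theta_mem_fundDomain hd, 1, ?_, by simpa using IsPowLattice.theta h⟩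
    simpa [matB] using sends_one (theta d)
  | succ k ih =>
    obtain ⟨hx, l, hl, hL⟩ := ih
    obtain ⟨l', hl', hL'⟩ := hL.loop h (im_pos_of_mem_fundDomain hx) (hloop k)
    refine ⟨(hloop k).2.2.2.mem, l * l', ?_, ?_⟩
    · rw [matB, mul_inv_rev, matA, inv_inv]
      exact hl'.mul hl
    · convert hL' using 1
      ring

theorem eq_of_eq (hE : E.IsExpansionOf ι (theta d)) {i j : ℕ} (hij : E.x i = E.x j) (k : ℕ) :
    E.x (k + i) = E.x (k + j) ∧ E.δ (k + i) = E.δ (k + j) ∧ E.a (k + i) = E.a (k + j) ∧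
      E.b (k + i) = E.b (k + j) := by
  have hloop := (isExpansionOf_iff.1 hE).2
  have hx : E.x (k + i) = E.x (k + j) := by
    induction k with
    | zero => simpa using hij
    | succ k ih =>
      have h1 := hloop (k + i)
      rw [ih] at h1
      have := (h1.unique (hloop (k + j))).2.2.2
      rwa [add_right_comm k i 1, add_right_comm k j 1] at this
  have h1 := hloop (k + i)
  rw [hx] at h1
  obtain ⟨h2, h3, h4, -⟩ := h1.unique (hloop (k + j))
  exact ⟨hx, h2, h3, h4⟩

end Expansion.IsExpansionOf

theorem existsUnique_expansion (h : IsSplitAt ι d) (hd : 0 < d) :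
    ∃! E : Expansion, E.IsExpansionOf ι (theta d) := by
  let S := {x : ℂ // 0 < x.im ∧ ∃ k c, IsPowLattice ι d k c x}
  have hstep : ∀ s : S, ∃ t : S, ∃ δ a bs, IsLoop ι s.1 δ a bs t.1 := by
    rintro ⟨x, hx, k, c, hL⟩
    obtain ⟨δ, a, bs, y, hy⟩ := hL.exists_loop h hd hx
    obtain ⟨l, -, hL'⟩ := hL.loop h hx hy
    exact ⟨⟨y, im_pos_of_mem_fundDomain hy.2.2.2.mem, _, _, hL'⟩, δ, a, bs, hy⟩
  choose next δ a bs hnext using hstep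
  let s : ℕ → S := fun n =>
    Nat.rec ⟨theta d, theta_im_pos hd, 0, 1, IsPowLattice.theta h⟩ (fun _ t => next t) n
  refine ⟨⟨fun n => (s n).1, fun n => δ (s n), fun n => a (s n), fun n => bs (s n)⟩,
    isExpansionOf_iff.2 ⟨rfl, fun k => hnext (s k)⟩, fun E hE => ?_⟩
  obtain ⟨h0, hloop⟩ := isExpansionOf_iff.1 hE
  have hx : ∀ k, E.x k = (s k).1 := by
    intro k
    induction k with
    | zero => exact h0
    | succ k ih =>
      have h1 := hloop k
      rw [ih] at h1
      exact (h1.unique (hnext (s k))).2.2.2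
  have hu : ∀ k, _ := fun k => (hx k ▸ hloop k).unique (hnext (s k))
  obtain ⟨x, δ', a', b'⟩ := E
  simp only [Expansion.mk.injEq]
  exact ⟨funext hx, funext fun k => (hu k).1, funext fun k => (hu k).2.1,
    funext fun k => (hu k).2.2.1⟩

/-! ### The matrices have entries in `ℤ[1/p]` -/

/-- The subring `ℤ[1/p]` of `ℚ`. -/
def pFractions (p : ℕ) [Fact p.Prime] : Subring ℚ where
  carrier := {q | ∃ (m : ℤ) (n : ℕ), q = (m : ℚ) / (p : ℚ) ^ n}
  zero_mem' := ⟨0, 0, by simp⟩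
  one_mem' := ⟨1, 0, by simp⟩
  neg_mem' := by
    rintro _ ⟨m, n, rfl⟩
    exact ⟨-m, n, by push_cast; ring⟩
  add_mem' := by
    rintro _ _ ⟨m, n, rfl⟩ ⟨m', n', rfl⟩
    have : (p : ℚ) ≠ 0 := by exact_mod_cast (Fact.out : p.Prime).ne_zero
    exact ⟨m * p ^ n' + m' * p ^ n, n + n', by push_cast; field_simp; ring⟩
  mul_mem' := by
    rintro _ _ ⟨m, n, rfl⟩ ⟨m', n', rfl⟩
    exact ⟨m * m', n + n', by push_cast; rw [pow_add, div_mul_div_comm]⟩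

/-- The matrices of determinant one with entries in `ℤ[1/p]`. -/
def HasPEntries (p : ℕ) [Fact p.Prime] (g : Matrix.SpecialLinearGroup (Fin 2) ℚ) : Prop :=
  ∀ i j, g i j ∈ pFractions p

theorem HasPEntries.mul {g h : Matrix.SpecialLinearGroup (Fin 2) ℚ} (hg : HasPEntries p g)
    (hh : HasPEntries p h) : HasPEntries p (g * h) := by
  intro i j
  rw [Matrix.SpecialLinearGroup.coe_mul, Matrix.mul_apply]
  exact sum_mem fun k _ => mul_mem (hg i k) (hh k j)

theorem HasPEntries.one : HasPEntries p 1 := by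
  intro i j
  fin_cases i <;> fin_cases j <;> simp [one_mem, zero_mem]

theorem hasPEntries_matD (δ : ℤ) : HasPEntries p (matD δ) := by
  by_cases h : δ = 1
  · rw [show matD δ = 1 from if_pos h]; exact HasPEntries.one
  · rw [show matD δ = ⟨!![0, -1; 1, 0], by simp⟩ from if_neg h]
    intro i j
    fin_cases i <;> fin_cases j <;> simp [one_mem, zero_mem]

theorem hasPEntries_matP (a : ℕ) : HasPEntries p (matP p a) := by
  have hinv : (p : ℚ)⁻¹ ∈ pFractions p := ⟨1, 1, by simp⟩
  intro i j
  fin_cases i <;> fin_cases j <;>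
    simp [matP, zero_mem, hinv, natCast_mem, mul_mem]

theorem hasPEntries_matQ (bs : List ℤ) : HasPEntries p (matQ bs) := by
  induction bs with
  | nil => exact .one
  | cons b bs ih =>
    refine ih.mul fun i j => ?_
    fin_cases i <;> fin_cases j <;> simp [one_mem, zero_mem, intCast_mem]

theorem hasPEntries_matB_inv (E : Expansion) (k : ℕ) : HasPEntries p (E.matB p k)⁻¹ := by
  induction k with
  | zero => simpa [Expansion.matB] using HasPEntries.one
  | succ k ih =>
    rw [Expansion.matB, mul_inv_rev, Expansion.matA, inv_inv]
    exact (((hasPEntries_matQ _).mul (hasPEntries_matP _)).mul (hasPEntries_matD _)).mul ih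

end PCF

namespace PCF

variable {p : ℕ} [Fact p.Prime] {d : ℕ} {ι : ℂ ≃+* PadicAlgCl p} {z w : ℂ}

/-! ### Powers of the ideal class -/

theorem span_eq_pow_iff (h : IsSplitAt ι d) (hd : Squarefree d) (k : ℕ) (u : 𝓞 (F d)) :
    Ideal.span {u} = primeAbove ι d ^ (2 * k) ↔ IsPowLattice ι d k ((u : F d) : ℂ) (theta d) := by
  have hmem : ∀ x : 𝓞 (F d), x ∈ Ideal.span {u} ↔
      ∃ m n : ℤ, ((x : F d) : ℂ) = ((u : F d) : ℂ) * (m * theta d + n) := by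
    intro x
    rw [Ideal.mem_span_singleton]
    constructor
    · rintro ⟨y, rfl⟩
      obtain ⟨m, n, hmn⟩ := isInt_coe hd y
      exact ⟨m, n, by simp [hmn]⟩
    · rintro ⟨m, n, hx⟩
      obtain ⟨y, hy⟩ := IsInt.exists_integer (d := d) ⟨m, n, rfl⟩
      refine ⟨y, NumberField.RingOfIntegers.ext (Subtype.ext ?_)⟩
      simp [hy, hx]
  constructor
  · intro he v
    constructor
    · rintro ⟨m, n, rfl⟩
      have hi : IsInt d (((u : F d) : ℂ) * (m * theta d + n)) := (isInt_coe hd u).mul ⟨m, n, rfl⟩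
      obtain ⟨x, hx⟩ := hi.exists_integer
      refine ⟨hi, ?_⟩
      rw [← hx, ← h.mem_primeAbove_pow hd, ← he, hmem]
      exact ⟨m, n, hx⟩
    · rintro ⟨hv, hv2⟩
      obtain ⟨x, rfl⟩ := hv.exists_integer
      rwa [← h.mem_primeAbove_pow hd, ← he, hmem] at hv2
  · intro hL
    ext x
    rw [hmem, hL, h.mem_primeAbove_pow hd]
    exact and_iff_right (isInt_coe hd x)

theorem primeClass_pow_eq_one_iff (ι : ℂ ≃+* PadicAlgCl p) (d n : ℕ) :
    primeClass ι d ^ n = 1 ↔ ∃ u, Ideal.span {u} = primeAbove ι d ^ n := by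
  rw [primeClass, ← map_pow, SubmonoidClass.mk_pow, ClassGroup.mk0_eq_one_iff]
  exact ⟨fun ⟨u, hu⟩ => ⟨u, hu.symm⟩, fun ⟨u, hu⟩ => ⟨u, hu.symm⟩⟩

theorem primeClass_pow_two_mul_eq_one_iff (h : IsSplitAt ι d) (hd : Squarefree d) (k : ℕ) :
    primeClass ι d ^ (2 * k) = 1 ↔ ∃ c, IsPowLattice ι d k c (theta d) := by
  rw [primeClass_pow_eq_one_iff]
  constructor
  · rintro ⟨u, hu⟩
    exact ⟨_, (span_eq_pow_iff h hd k u).1 hu⟩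
  · rintro ⟨c, hc⟩
    obtain ⟨u, rfl⟩ := hc.mem_left.1.exists_integer
    exact ⟨u, (span_eq_pow_iff h hd k u).2 hc⟩

theorem IsPowLattice.eq_of_mem_fundDomain {k : ℕ} {c c' x y : ℂ} (hx : x ∈ fundDomain)
    (hy : y ∈ fundDomain) (h : IsPowLattice ι d k c x) (h' : IsPowLattice ι d k c' y) : x = y := by
  have hc' := h'.ne_zero
  refine eq_of_lattice_eq (c := c / c') hx hy fun v => ?_
  have h1 := (h (c' * v)).trans (h' (c' * v)).symm
  simp only [mul_right_inj' hc'] at h1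
  rw [← h1]
  refine exists_congr fun m => exists_congr fun n => ?_
  rw [div_mul_eq_mul_div, eq_div_iff hc', mul_comm]

theorem Expansion.IsExpansionOf.eq_theta_iff {E : Expansion} (hE : E.IsExpansionOf ι (theta d))
    (h : IsSplitAt ι d) (hd : Squarefree d) (k : ℕ) :
    E.x k = theta d ↔ primeClass ι d ^ (2 * k) = 1 := by
  have hd0 : 0 < d := Nat.pos_of_ne_zero hd.ne_zero
  obtain ⟨hx, l, -, hL⟩ := hE.exists_isPowLattice h hd0 k
  rw [primeClass_pow_two_mul_eq_one_iff h hd]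
  constructor
  · intro he
    exact ⟨_, he ▸ hL⟩
  · rintro ⟨c, hc⟩
    exact hL.eq_of_mem_fundDomain hx (theta_mem_fundDomain hd0) hc

/-! ### Roots of unity -/

theorem map_eq_or_eq_conj (φ : F d →+* ℂ) (x : F d) :
    φ x = x ∨ φ x = (starRingEnd ℂ) (x : ℂ) := by
  obtain ⟨a, b, hab⟩ := exists_of_mem_F x.2
  let s : F d := ⟨sqrtNeg d, sqrtNeg_mem d⟩
  have hx : x = a * s + b := Subtype.ext (by simp [hab, s])
  have hs : s ^ 2 = -(d : F d) := Subtype.ext (by simp [s, sqrtNeg_sq])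
  have h1 : φ s ^ 2 = sqrtNeg d ^ 2 := by rw [← map_pow, hs, sqrtNeg_sq]; simp
  have h2 : φ x = a * φ s + b := by rw [hx]; simp
  rw [h2, hab]
  rcases sq_eq_sq_iff_eq_or_eq_neg.1 h1 with h | h
  · exact .inl (by rw [h])
  · exact .inr (by rw [h]; simp [conj_sqrtNeg])

theorem IsInt.exists_pow_eq_one (hz : IsInt d z) (h : z * (starRingEnd ℂ) z = 1) :
    ∃ n : ℕ, 0 < n ∧ z ^ n = 1 := by
  obtain ⟨x, rfl⟩ := hz.exists_integer
  have hn : ‖((x : F d) : ℂ)‖ = 1 := by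
    have h1 : Complex.normSq ((x : F d) : ℂ) = 1 := by
      rw [Complex.mul_conj] at h; exact_mod_cast h
    rw [Complex.normSq_eq_norm_sq] at h1
    exact (pow_eq_one_iff_of_nonneg (norm_nonneg _) two_ne_zero).1 h1
  obtain ⟨n, hn0, hn1⟩ := NumberField.Embeddings.pow_eq_one_of_norm_eq_one (F d) ℂ
    (x := (x : F d)) x.isIntegral_coe (fun φ => by
      rcases map_eq_or_eq_conj φ (x : F d) with h | h
      · rw [h, hn]
      · rw [h, Complex.norm_conj, hn])
  exact ⟨n, hn0, by simpa using congrArg (Subtype.val : F d → ℂ) hn1⟩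

theorem IsInt.exists_natCast_eq (hz : IsInt d z) : ∃ n : ℕ, z * (starRingEnd ℂ) z = n := by
  obtain ⟨a, b, rfl⟩ := hz
  set k : ℤ := a ^ 2 * thetaNm d + a * b * thetaTr d + b ^ 2
  have h1 : ((a : ℂ) * theta d + b) * (starRingEnd ℂ) (a * theta d + b) = (k : ℤ) := by
    simp [conj_theta, k]
    linear_combination (-a ^ 2 : ℂ) * theta_sq d
  have h2 : 0 ≤ k := by
    have := Complex.normSq_nonneg ((a : ℂ) * theta d + b)
    rw [Complex.mul_conj] at h1
    have h3 : Complex.normSq ((a : ℂ) * theta d + b) = k := by exact_mod_cast h1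
    rw [h3] at this
    exact_mod_cast this
  exact ⟨k.toNat, by rw [h1]; exact_mod_cast (Int.toNat_of_nonneg h2).symm⟩

theorem isOfFinOrder_unit (hd : Squarefree d) (v : (𝓞 (F d))ˣ) :
    IsOfFinOrder ((v : 𝓞 (F d)) : F d) := by
  have hv := isInt_coe hd (v : 𝓞 (F d))
  obtain ⟨m, hm⟩ := hv.exists_natCast_eq
  obtain ⟨n, hn⟩ := (isInt_coe hd ((v⁻¹ : (𝓞 (F d))ˣ) : 𝓞 (F d))).exists_natCast_eq
  have h1 : ((((v : 𝓞 (F d)) : F d) : ℂ)) * ((((v⁻¹ : (𝓞 (F d))ˣ) : 𝓞 (F d)) : F d) : ℂ) = 1 := by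
    have : (v : 𝓞 (F d)) * ((v⁻¹ : (𝓞 (F d))ˣ) : 𝓞 (F d)) = 1 := v.mul_inv
    simpa only [map_mul, IntermediateField.coe_mul, map_one, IntermediateField.coe_one]
      using congrArg (fun x : 𝓞 (F d) => ((x : F d) : ℂ)) this
  have h2 : m * n = 1 := by
    have h3 : (m : ℂ) * n = 1 := by
      rw [← hm, ← hn, mul_mul_mul_comm, ← map_mul, h1, map_one, one_mul]
    exact_mod_cast h3
  rw [Nat.eq_one_of_mul_eq_one_right h2, Nat.cast_one] at hm
  obtain ⟨k, hk0, hk⟩ := hv.exists_pow_eq_one hm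
  exact isOfFinOrder_iff_pow_eq_one.2 ⟨k, hk0, Subtype.ext (by simpa using hk)⟩

theorem primeClass_pow_eq_one_iff_exists_isOfFinOrder (hd : Squarefree d) {N : ℕ} {u : 𝓞 (F d)}
    (hu : Ideal.span {u} = primeAbove ι d ^ (2 * N)) :
    primeClass ι d ^ N = 1 ↔ ∃ x : 𝓞 (F d), IsOfFinOrder ((u : F d) / (x : F d) ^ 2) := by
  rw [primeClass_pow_eq_one_iff]
  rw [mul_comm, pow_mul] at hu
  have hP0 : primeAbove ι d ^ N ≠ ⊥ := pow_ne_zero _ (primeAbove_ne_bot ι d)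
  constructor
  · rintro ⟨x, hx⟩
    have hx0 : (x : F d) ≠ 0 := by
      rintro h0
      have h0' : x = 0 := NumberField.RingOfIntegers.ext h0
      rw [h0'] at hx
      exact hP0 (by simpa using hx.symm)
    rw [← hx, Ideal.span_singleton_pow, Ideal.span_singleton_eq_span_singleton] at hu
    obtain ⟨v, hv⟩ := hu.symm
    refine ⟨x, ?_⟩
    have : (u : F d) / (x : F d) ^ 2 = ((v : 𝓞 (F d)) : F d) := by
      rw [← hv, div_eq_iff (pow_ne_zero 2 hx0)]; push_cast; ring
    rw [this]
    exact isOfFinOrder_unit hd v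
  · rintro ⟨x, hx⟩
    refine ⟨x, ?_⟩
    have hint : ∀ y : F d, IsOfFinOrder y → ∃ t : 𝓞 (F d), (t : F d) = y := by
      intro y hy
      obtain ⟨n, hn0, hn⟩ := isOfFinOrder_iff_pow_eq_one.1 hy
      exact ⟨⟨y, IsIntegral.of_pow hn0 (hn ▸ isIntegral_one)⟩, rfl⟩
    have hx0 : (x : F d) ^ 2 ≠ 0 := by
      intro h0
      rw [h0, div_zero] at hx
      obtain ⟨n, hn0, hn⟩ := isOfFinOrder_iff_pow_eq_one.1 hx
      rw [zero_pow hn0.ne'] at hn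
      exact zero_ne_one hn
    obtain ⟨t, ht⟩ := hint _ hx
    obtain ⟨n, hn0, hn⟩ := isOfFinOrder_iff_pow_eq_one.1 hx
    have htu : IsUnit t := by
      refine IsUnit.of_pow_eq_one (n := n) (NumberField.RingOfIntegers.ext ?_) hn0.ne'
      simpa [ht] using hn
    have hux : u = x ^ 2 * t := by
      apply NumberField.RingOfIntegers.ext
      exact ((eq_div_iff hx0).1 ht).symm.trans (mul_comm _ _)
    rw [hux, Ideal.span_singleton_mul_right_unit htu, ← Ideal.span_singleton_pow] at hu
    apply dvd_antisymm <;> rw [← UniqueFactorizationMonoid.pow_dvd_pow_iff_dvd two_ne_zero, hu]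

theorem orderOf_eq_or {G : Type*} [Group G] [Finite G] {g : G} {N : ℕ}
    (hN : IsLeast {n | 0 < n ∧ g ^ (2 * n) = 1} N) :
    (∀ k : ℤ, g ^ (2 * k) = 1 → (N : ℤ) ∣ k) ∧ (g ^ N = 1 → orderOf g = N) ∧
      (g ^ N ≠ 1 → orderOf g = 2 * N) := by
  obtain ⟨⟨hN0, hN1⟩, hmin⟩ := hN
  have hord : orderOf (g ^ 2) = N := by
    rw [orderOf_eq_iff hN0]
    refine ⟨by rwa [← pow_mul], fun m hm hm0 h1 => ?_⟩
    exact absurd (hmin ⟨hm0, by rwa [pow_mul]⟩) (by omega)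
  have hdvd : ∀ k : ℤ, g ^ (2 * k) = 1 → (N : ℤ) ∣ k := by
    intro k hk
    rw [← hord]
    rw [orderOf_dvd_iff_zpow_eq_one, ← zpow_natCast, ← zpow_mul]
    exact_mod_cast hk
  have h1 : N ∣ orderOf g := by
    have := hdvd (orderOf g) (by rw [mul_comm, zpow_mul, zpow_natCast, pow_orderOf_eq_one, one_zpow])
    exact_mod_cast this
  refine ⟨hdvd, fun h => Nat.dvd_antisymm (orderOf_dvd_of_pow_eq_one h) h1, fun h => ?_⟩
  obtain ⟨j, hj⟩ := h1
  have h2 : orderOf g ∣ 2 * N := orderOf_dvd_of_pow_eq_one hN1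
  rw [hj, mul_comm] at h2
  have h3 : j ∣ 2 := Nat.dvd_of_mul_dvd_mul_right hN0 h2
  rcases (Nat.dvd_prime Nat.prime_two).1 h3 with rfl | rfl
  · rw [mul_one] at hj
    exact absurd (hj ▸ pow_orderOf_eq_one g) h
  · rw [hj, mul_comm]

end PCF

namespace PCF

variable {p d : ℕ} {z w : ℂ}

/-! ### Norm one `p`-units -/

/-- `z` lies in `ℤ[θ][1/p]`. -/
def IsPInt (p d : ℕ) (z : ℂ) : Prop := ∃ n : ℕ, IsInt d ((p : ℂ) ^ n * z)

theorem IsInt.isPInt (hz : IsInt d z) : IsPInt p d z := ⟨0, by simpa using hz⟩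

theorem IsInt.natCast_pow (n : ℕ) : IsInt d ((p : ℂ) ^ n) := by
  exact_mod_cast IsInt.natCast (p ^ n)

theorem IsPInt.mul (hz : IsPInt p d z) (hw : IsPInt p d w) : IsPInt p d (z * w) := by
  obtain ⟨m, hm⟩ := hz
  obtain ⟨n, hn⟩ := hw
  exact ⟨m + n, by convert hm.mul hn using 1; ring⟩

theorem IsPInt.add (hz : IsPInt p d z) (hw : IsPInt p d w) : IsPInt p d (z + w) := by
  obtain ⟨m, hm⟩ := hz
  obtain ⟨n, hn⟩ := hw
  refine ⟨m + n, ?_⟩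
  convert ((IsInt.natCast_pow (p := p) n).mul hm).add ((IsInt.natCast_pow (p := p) m).mul hn)
    using 1
  ring

theorem IsPInt.conj (hz : IsPInt p d z) : IsPInt p d ((starRingEnd ℂ) z) := by
  obtain ⟨n, hn⟩ := hz
  exact ⟨n, by simpa using hn.conj⟩

/-- The inclusion of the norm one `p`-units in `ℂ`. -/
def normOneUnitsToComplex (p d : ℕ) : normOneUnits p d →* ℂˣ :=
  (Units.map (((algebraMap (F d) ℂ : F d →+* ℂ) : F d →* ℂ).comp
    ((pIntegers p d).val : pIntegers p d →* F d))).comp (normOneUnits p d).subtype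

theorem normOneUnitsToComplex_apply (η : normOneUnits p d) :
    (normOneUnitsToComplex p d η : ℂ) = ((((η : (pIntegers p d)ˣ) : pIntegers p d) : F d) : ℂ) :=
  rfl

theorem normOneUnitsToComplex_injective (p d : ℕ) :
    Function.Injective (normOneUnitsToComplex p d) := by
  intro x y h
  have h1 := congrArg (Units.val : ℂˣ → ℂ) h
  rw [normOneUnitsToComplex_apply, normOneUnitsToComplex_apply] at h1
  exact Subtype.ext (Units.ext (Subtype.ext (Subtype.ext h1)))

variable [Fact p.Prime] {ι : ℂ ≃+* PadicAlgCl p}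

theorem isPInt_inv_pow (n : ℕ) : IsPInt p d ((p : ℂ) ^ n)⁻¹ :=
  ⟨n, by rw [mul_inv_cancel₀ (pow_ne_zero _ p_ne_zero)]; simpa using IsInt.natCast (d := d) 1⟩

theorem IsPInt.isInt (hz : IsPInt p d z) (h : IsSplitAt ι d) (h1 : ‖ι z‖ ≤ 1)
    (h2 : ‖ι ((starRingEnd ℂ) z)‖ ≤ 1) : IsInt d z := by
  obtain ⟨n, hn⟩ := hz
  obtain ⟨w, hw, e⟩ := h.exists_eq_pow_mul (n := n) hn
    (by simpa using norm_map_mul_le (norm_natCast_pow (ι := ι) n).le h1)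
    (by
      rw [map_mul, map_pow, Complex.conj_natCast]
      simpa using norm_map_mul_le (norm_natCast_pow (ι := ι) n).le h2)
  rwa [mul_left_cancel₀ (pow_ne_zero _ p_ne_zero) e]

theorem isPInt_coe (hd : Squarefree d) (x : pIntegers p d) : IsPInt p d ((x : F d) : ℂ) := by
  obtain ⟨x, hx⟩ := x
  induction hx using Algebra.adjoin_induction with
  | mem x hx =>
    obtain rfl := Set.mem_singleton_iff.1 hx
    simpa using isPInt_inv_pow (p := p) (d := d) 1
  | algebraMap r => exact (isInt_coe hd r).isPInt
  | add x y hx hy h1 h2 => exact h1.add h2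
  | mul x y hx hy h1 h2 => exact h1.mul h2

theorem IsPInt.exists_coe (hz : IsPInt p d z) : ∃ x : pIntegers p d, ((x : F d) : ℂ) = z := by
  obtain ⟨n, hn⟩ := hz
  obtain ⟨y, hy⟩ := hn.exists_integer
  let q : pIntegers p d := ⟨(p : F d)⁻¹, Algebra.subset_adjoin rfl⟩
  refine ⟨algebraMap (𝓞 (F d)) (pIntegers p d) y * q ^ n, ?_⟩
  have e : ((((algebraMap (𝓞 (F d)) (pIntegers p d) y * q ^ n : pIntegers p d)) : F d) : ℂ) =
      ((y : F d) : ℂ) * ((p : ℂ)⁻¹) ^ n := by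
    simp [q]
  rw [e, hy, inv_pow, mul_right_comm, mul_inv_cancel₀ (pow_ne_zero _ p_ne_zero), one_mul]

theorem normOneUnitsToComplex_spec (hd : Squarefree d) (η : normOneUnits p d) :
    IsPInt p d (normOneUnitsToComplex p d η) ∧
      (normOneUnitsToComplex p d η : ℂ) * (starRingEnd ℂ) (normOneUnitsToComplex p d η : ℂ) = 1 := by
  rw [normOneUnitsToComplex_apply]
  refine ⟨isPInt_coe hd _, ?_⟩
  rw [← norm_eq_mul_conj (Nat.pos_of_ne_zero hd.ne_zero)]
  have := η.2
  rw [MonoidHom.mem_ker] at this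
  exact_mod_cast this

theorem exists_normOneUnit (hd : 0 < d) (hz : IsPInt p d z) (h : z * (starRingEnd ℂ) z = 1) :
    ∃ η : normOneUnits p d, (normOneUnitsToComplex p d η : ℂ) = z := by
  obtain ⟨x, hx⟩ := hz.exists_coe
  obtain ⟨y, hy⟩ := hz.conj.exists_coe
  have hxy : x * y = 1 := by
    apply Subtype.ext
    apply Subtype.ext
    simp [hx, hy, h]
  refine ⟨⟨⟨x, y, hxy, by rw [mul_comm, hxy]⟩, ?_⟩, hx⟩
  rw [MonoidHom.mem_ker]
  have h1 := norm_eq_mul_conj hd (x : F d)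
  rw [hx, h] at h1
  have h2 : Algebra.norm ℚ (x : F d) = 1 := by exact_mod_cast h1
  exact h2

theorem norm_conj_eq_inv (h : z * (starRingEnd ℂ) z = 1) :
    ‖ι ((starRingEnd ℂ) z)‖ = ‖ι z‖⁻¹ := by
  have h1 : ‖ι z‖ * ‖ι ((starRingEnd ℂ) z)‖ = 1 := by
    rw [← norm_mul, ← map_mul, h, map_one, norm_one]
  exact eq_inv_of_mul_eq_one_right h1

theorem IsPInt.exists_norm_eq (hz : IsPInt p d z) (h : IsSplitAt ι d) (h0 : z ≠ 0) :
    ∃ a : ℤ, ‖ι z‖ = (p : ℝ) ^ (-a) := by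
  obtain ⟨n, hn⟩ := hz
  have h1 := div_mem (h.mem_fieldRange hn) (h.mem_fieldRange (IsInt.natCast_pow (p := p) n))
  rw [← map_div₀, mul_div_cancel_left₀ _ (pow_ne_zero _ p_ne_zero)] at h1
  obtain ⟨q, hq⟩ := h1
  have hq0 : q ≠ 0 := by
    rintro rfl
    rw [map_zero] at hq
    exact h0 (ι.map_eq_zero_iff.1 hq.symm)
  exact ⟨q.valuation, by rw [← hq, PadicAlgCl.norm_extends, Padic.norm_eq_zpow_neg_valuation hq0]⟩

/-- A norm one `p`-unit of absolute value `p ^ (-a)` yields a generator of `𝔭 ^ (2 a)`. -/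
theorem IsPInt.isPowLattice (hz : IsPInt p d z) (h : IsSplitAt ι d)
    (h1 : z * (starRingEnd ℂ) z = 1) {a : ℕ} (ha : ‖ι z‖ = (p : ℝ) ^ (-a : ℤ)) :
    IsPowLattice ι d a ((p : ℂ) ^ a * z) (theta d) := by
  have hpa := norm_natCast_pow (ι := ι) a
  have hc := norm_conj_eq_inv (ι := ι) h1
  have hpr : (p : ℝ) ≠ 0 := p_pos.ne'
  have hpc : (p : ℂ) ≠ 0 := p_ne_zero
  have hn1 : ‖ι ((p : ℂ) ^ a * z)‖ = (p : ℝ) ^ (-(2 * a : ℕ) : ℤ) := by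
    rw [map_mul, norm_mul, hpa, ha, ← zpow_add₀ hpr]; congr 1; push_cast; ring
  have hn2 : ‖ι ((starRingEnd ℂ) ((p : ℂ) ^ a * z))‖ = 1 := by
    rw [map_mul, map_pow, Complex.conj_natCast, map_mul, norm_mul, hpa, hc, ha]
    exact mul_inv_cancel₀ (zpow_ne_zero _ hpr)
  have hu : IsInt d ((p : ℂ) ^ a * z) := by
    refine ((IsInt.natCast_pow a).isPInt.mul hz).isInt h ?_ hn2.le
    rw [hn1]; exact zpow_neg_le_one _
  intro v
  constructor
  · rintro ⟨m, n, rfl⟩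
    have hmn : IsInt d (m * theta d + n) := ⟨m, n, rfl⟩
    exact ⟨hu.mul hmn, by simpa using norm_map_mul_le hn1.le (h.norm_le_one hmn)⟩
  · rintro ⟨hv1, hv2⟩
    have hz0 : z ≠ 0 := left_ne_zero_of_mul_eq_one h1
    have hw : IsPInt p d (v * (((p : ℂ) ^ a)⁻¹ * (starRingEnd ℂ) z)) :=
      hv1.isPInt.mul ((isPInt_inv_pow a).mul hz.conj)
    have e : v = ((p : ℂ) ^ a * z) * (v * (((p : ℂ) ^ a)⁻¹ * (starRingEnd ℂ) z)) := by
      field_simp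
      linear_combination -v * h1
    have hwi : IsInt d (v * (((p : ℂ) ^ a)⁻¹ * (starRingEnd ℂ) z)) := by
      refine hw.isInt h ?_ ?_
      · rw [e, map_mul, norm_mul, hn1] at hv2
        nth_rewrite 2 [← mul_one ((p : ℝ) ^ (-(2 * a : ℕ) : ℤ))] at hv2
        exact le_of_mul_le_mul_left hv2 (zpow_pos p_pos _)
      · have h3 := h.norm_le_one hv1.conj
        rwa [e, map_mul, map_mul, norm_mul, hn2, one_mul] at h3
    obtain ⟨m, n, hmn⟩ := hwi
    exact ⟨m, n, by rw [← hmn]; exact e⟩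

/-- A norm one `p`-unit that generates the smallest power of `𝔭 / 𝔭̄` that is principal is
fundamental. -/
theorem isFundamentalNormOneUnit_of_dvd (h : IsSplitAt ι d) (hd : Squarefree d) {N : ℕ}
    (hN : 0 < N) (hz : IsPInt p d z) (h1 : z * (starRingEnd ℂ) z = 1)
    (hzN : ‖ι z‖ = (p : ℝ) ^ (-N : ℤ))
    (hdvd : ∀ k : ℕ, (∃ c, IsPowLattice ι d k c (theta d)) → N ∣ k) :
    IsFundamentalNormOneUnit p d z := by
  have hd0 : 0 < d := Nat.pos_of_ne_zero hd.ne_zero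
  have hpr : (p : ℝ) ≠ 0 := p_pos.ne'
  obtain ⟨η, hη⟩ := exists_normOneUnit hd0 hz h1
  have hfin : ∀ x : normOneUnits p d, IsOfFinOrder x ↔ ‖ι (normOneUnitsToComplex p d x)‖ = 1 := by
    intro x
    constructor
    · intro hx
      obtain ⟨n, hn0, hn⟩ := isOfFinOrder_iff_pow_eq_one.1 hx
      have h2 : (normOneUnitsToComplex p d x : ℂ) ^ n = 1 := by
        rw [← Units.val_pow_eq_pow_val, ← map_pow, hn, map_one, Units.val_one]
      have h3 : ‖ι (normOneUnitsToComplex p d x)‖ ^ n = 1 := by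
        rw [← norm_pow, ← map_pow, h2, map_one, norm_one]
      exact (pow_eq_one_iff_of_nonneg (norm_nonneg _) hn0.ne').1 h3
    · intro hx
      obtain ⟨hx1, hx2⟩ := normOneUnitsToComplex_spec hd x
      have hi := hx1.isInt h hx.le (by rw [norm_conj_eq_inv hx2, hx, inv_one])
      obtain ⟨n, hn0, hn⟩ := hi.exists_pow_eq_one hx2
      refine isOfFinOrder_iff_pow_eq_one.2 ⟨n, hn0, normOneUnitsToComplex_injective p d ?_⟩
      apply Units.ext
      rw [map_pow, Units.val_pow_eq_pow_val, hn, map_one, Units.val_one]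
  have hnorm : ∀ k : ℤ, ‖ι (normOneUnitsToComplex p d (η ^ k))‖ = (p : ℝ) ^ (-(N * k) : ℤ) := by
    intro k
    rw [map_zpow, Units.val_zpow_eq_zpow_val, hη, map_zpow₀, norm_zpow, hzN, ← zpow_mul, neg_mul]
  have hN' : ∀ (w : ℂ) (a : ℤ), IsPInt p d w → w * (starRingEnd ℂ) w = 1 →
      ‖ι w‖ = (p : ℝ) ^ (-a) → (N : ℤ) ∣ a := by
    intro w a hw hw1 ha
    rcases le_total 0 a with h0 | h0
    · lift a to ℕ using h0
      exact_mod_cast hdvd a ⟨_, hw.isPowLattice h hw1 ha⟩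
    · obtain ⟨b, rfl⟩ := Int.exists_eq_neg_ofNat h0
      rw [dvd_neg]
      refine Int.natCast_dvd_natCast.2 (hdvd b ⟨_, hw.conj.isPowLattice h (a := b) ?_ ?_⟩)
      · rw [Complex.conj_conj, mul_comm, hw1]
      · rw [norm_conj_eq_inv hw1, ha, ← zpow_neg, neg_neg]
  refine ⟨η, hη, ?_, ?_⟩
  · rw [Subgroup.eq_top_iff']
    intro q
    obtain ⟨x, rfl⟩ := QuotientGroup.mk_surjective q
    obtain ⟨hx1, hx2⟩ := normOneUnitsToComplex_spec hd x
    obtain ⟨a, ha⟩ := hx1.exists_norm_eq h (Units.ne_zero _)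
    obtain ⟨k, rfl⟩ := hN' _ a hx1 hx2 ha
    refine Subgroup.mem_zpowers_iff.2 ⟨k, ?_⟩
    rw [← QuotientGroup.mk_zpow, QuotientGroup.eq, CommGroup.mem_torsion, hfin, map_mul,
      Units.val_mul, map_mul, norm_mul, ha, ← zpow_neg, hnorm, ← zpow_add₀ hpr]
    simp
  · intro hcon
    obtain ⟨n, hn0, hn⟩ := isOfFinOrder_iff_pow_eq_one.1 hcon
    rw [← QuotientGroup.mk_pow, QuotientGroup.eq_one_iff, CommGroup.mem_torsion, hfin,
      ← zpow_natCast, hnorm] at hn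
    have h5 : (-(N * n : ℤ)) = 0 := by
      by_contra h6
      exact (zpow_right_injective₀ p_pos one_lt_p.ne').ne h6 (by rw [hn, zpow_zero])
    have : N * n = 0 := by exact_mod_cast neg_eq_zero.1 h5
    rcases mul_eq_zero.1 this with h | h <;> omega

theorem Sends.mul_conj_eq_one {g : Matrix.SpecialLinearGroup (Fin 2) ℚ} {x l : ℂ} (hx : 0 < x.im)
    (hg : Sends g x x l) : l * (starRingEnd ℂ) l = 1 := by
  obtain ⟨h1, h2⟩ := hg
  have hdet : (g 0 0 : ℂ) * g 1 1 - g 0 1 * g 1 0 = 1 := by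
    have := g.2
    rw [Matrix.det_fin_two] at this
    exact_mod_cast this
  have h3 := congrArg (starRingEnd ℂ) h1
  have h4 := congrArg (starRingEnd ℂ) h2
  simp only [map_add, map_mul, map_ratCast] at h3 h4
  have hne : x - (starRingEnd ℂ) x ≠ 0 := by
    intro h0
    have := congrArg Complex.im h0
    simp at this
    linarith
  apply mul_right_cancel₀ hne
  linear_combination (-(starRingEnd ℂ) l) * h1 + l * h3 - (g 0 0 * x + g 0 1 : ℂ) * h4 +
    (g 0 0 * (starRingEnd ℂ) x + g 0 1 : ℂ) * h2 + (x - (starRingEnd ℂ) x) * hdet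

end PCF

namespace PCF

variable {p d : ℕ}

theorem IsPowLattice.isCoprime [Fact p.Prime] {ι : ℂ ≃+* PadicAlgCl p} {k : ℕ} {s t : ℤ}
    (h : IsSplitAt ι d) (hd : 0 < d)
    (hL : IsPowLattice ι d k (s * PCF.theta d + t) (PCF.theta d)) : IsCoprime s t := by
  obtain ⟨g, hg⟩ := h.exists_norm_sub_le (2 * k)
  obtain ⟨m, n, hmn⟩ := (hL _).2 ⟨isInt_theta.sub (.intCast g), hg⟩
  have e : ((1 : ℤ) : ℂ) * PCF.theta d + ((-g : ℤ) : ℂ) =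
      ((s * m * thetaTr d + s * n + t * m : ℤ) : ℂ) * PCF.theta d +
        ((t * n - s * m * thetaNm d : ℤ) : ℂ) := by
    push_cast
    linear_combination hmn + (s * m : ℂ) * theta_sq d
  exact ⟨m * thetaTr d + n, m, by linear_combination -(theta_coeff_eq_int hd e).1⟩

theorem Sends.exists_int {g : Matrix.SpecialLinearGroup (Fin 2) ℚ} {x l : ℂ} {N : ℕ}
    (hd : 0 < d) (hg : Sends g (theta d) x l) (hu : IsInt d ((p : ℂ) ^ N * l)) :
    ∃ s t : ℤ, (s : ℚ) = (p : ℚ) ^ N * g 1 0 ∧ (t : ℚ) = (p : ℚ) ^ N * g 1 1 ∧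
      (p : ℂ) ^ N * l = s * theta d + t := by
  obtain ⟨s, t, hst⟩ := hu
  have e : ((s : ℚ) : ℂ) * theta d + ((t : ℚ) : ℂ) =
      (((p : ℚ) ^ N * g 1 0 : ℚ) : ℂ) * theta d + (((p : ℚ) ^ N * g 1 1 : ℚ) : ℂ) := by
    push_cast
    linear_combination -hst - (p : ℂ) ^ N * hg.2
  obtain ⟨h1, h2⟩ := theta_coeff_eq_rat hd e
  exact ⟨s, t, h1, h2, hst⟩

end PCF

end

theorem theorem4p14 (p : ℕ) [Fact p.Prime] (ι : ℂ ≃+* PadicAlgCl p)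
    (d : ℕ) (hd : Squarefree d) (hp : PCF.SplitsCompletely p (PCF.F d)) :
    -- the expansion of `θ` exists and is unique
    (∃! E : PCF.Expansion, E.IsExpansionOf ι (PCF.theta d)) ∧
    ∀ E : PCF.Expansion, E.IsExpansionOf ι (PCF.theta d) →
      -- (i) it is purely periodic
      (∃ N : ℕ, 0 < N ∧ E.x N = PCF.theta d ∧
        ∀ k, E.x (k + N) = E.x k ∧ E.δ (k + N) = E.δ k ∧ E.a (k + N) = E.a k ∧
          E.b (k + N) = E.b k) ∧
      ∀ N : ℕ, IsLeast {n : ℕ | 0 < n ∧ E.x n = PCF.theta d} N →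
        -- `B_N⁻¹` has entries in `ℤ[1/p]`
        (∀ i j, ∃ (m : ℤ) (n : ℕ), (E.matB p N)⁻¹ i j = (m : ℚ) / (p : ℚ) ^ n) ∧
        -- (ii) `ε = s_N θ + t_N` is a fundamental norm one `p`-unit
        PCF.IsFundamentalNormOneUnit p d
          (((E.matB p N)⁻¹ 1 0 : ℚ) * PCF.theta d + ((E.matB p N)⁻¹ 1 1 : ℚ)) ∧
        -- (iii)
        ∃ s t : ℤ, (s : ℚ) = (p : ℚ) ^ N * (E.matB p N)⁻¹ 1 0 ∧
          (t : ℚ) = (p : ℚ) ^ N * (E.matB p N)⁻¹ 1 1 ∧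
          IsCoprime s t ∧
          ∃ u : 𝓞 (PCF.F d), ((u : PCF.F d) : ℂ) = s * PCF.theta d + t ∧
            Ideal.span {u} = PCF.primeAbove ι d ^ (2 * N) ∧
            ((∃ x : 𝓞 (PCF.F d), IsOfFinOrder ((u : PCF.F d) / (x : PCF.F d) ^ 2)) →
              orderOf (PCF.primeClass ι d) = N) ∧
            ((¬ ∃ x : 𝓞 (PCF.F d), IsOfFinOrder ((u : PCF.F d) / (x : PCF.F d) ^ 2)) →
              orderOf (PCF.primeClass ι d) = 2 * N) := by
  have hd0 : 0 < d := Nat.pos_of_ne_zero hd.ne_zero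
  have h := PCF.isSplitAt_of_splitsCompletely ι hd hp
  refine ⟨PCF.existsUnique_expansion h hd0, fun E hE => ?_⟩
  have hiff := hE.eq_theta_iff h hd
  refine ⟨⟨orderOf (PCF.primeClass ι d), orderOf_pos _, ?_, fun k => ?_⟩, fun N hN => ?_⟩
  · rw [hiff, mul_comm, pow_mul, pow_orderOf_eq_one, one_pow]
  · refine hE.eq_of_eq (j := 0) ?_ k
    rw [hE.start, hiff, mul_comm, pow_mul, pow_orderOf_eq_one, one_pow]
  obtain ⟨-, l, hl, hL⟩ := hE.exists_isPowLattice h hd0 N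
  rw [hN.1.2] at hl hL
  simp only [hiff] at hN
  obtain ⟨hdvd, hord1, hord2⟩ := PCF.orderOf_eq_or hN
  have hl1 := hl.mul_conj_eq_one (PCF.theta_im_pos hd0)
  have hlN : ‖ι l‖ = (p : ℝ) ^ (-N : ℤ) := by
    have h1 := hL.norm_left (h.inZp PCF.isInt_theta)
    rw [map_mul, norm_mul, PCF.norm_natCast_pow] at h1
    refine mul_left_cancel₀ (zpow_ne_zero (-N : ℤ) PCF.p_pos.ne') (h1.trans ?_)
    rw [← zpow_add₀ PCF.p_pos.ne']
    congr 1; push_cast; ring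
  refine ⟨PCF.hasPEntries_matB_inv E N, ?_, ?_⟩
  · rw [hl.2]
    refine PCF.isFundamentalNormOneUnit_of_dvd h hd hN.1.1 ⟨N, hL.mem_left.1⟩ hl1 hlN fun k hk => ?_
    rw [← PCF.primeClass_pow_two_mul_eq_one_iff h hd] at hk
    exact_mod_cast hdvd k (by exact_mod_cast hk)
  · obtain ⟨s, t, hs, ht, hst⟩ := hl.exists_int hd0 hL.mem_left.1
    rw [hst] at hL
    obtain ⟨u, hu⟩ := hL.mem_left.1.exists_integer
    have hspan := (PCF.span_eq_pow_iff h hd N u).2 (by rwa [hu])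
    refine ⟨s, t, hs, ht, hL.isCoprime h hd0, u, hu, hspan, ?_⟩
    rw [← PCF.primeClass_pow_eq_one_iff_exists_isOfFinOrder hd hspan]
    exact ⟨hord1, hord2⟩
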